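/- Let $f,\ h_i\ (1\le i\le m),\ g_j\ (1\le j\le p):\mathbb{R}^n\to\mathbb{R}$ be twice continuously differentiable, and let $x^*$ be a local minimizer of $f$ over $\Omega=\{x: h_i(x)=0\ \forall i,\ g_j(x)\le 0\ \forall j\}$ (in particular $x^*\in\Omega$). Let $A=\{j: g_j(x^*)=0\}$ and $q=|A|$, and let $J(x)\in\mathbb{R}^{(m+q)\times n}$ be the matrix with rows $\nabla h_i(x)^{\mathtt T}$ $(1\le i\le m)$ followed by $\nabla g_j(x)^{\mathtt T}$ $(j\in A)$. Let $L(x,\lambda,\mu)=f(x)+\sum_{i=1}^m\lambda_i h_i(x)+\sum_{j=1}^p\mu_j g_j(x)$, and let $$\Lambda(x^*)=\{(\lambda,\mu)\in\mathbb{R}^m\times\mathbb{R}^p_+ : \nabla_x L(x^*,\lambda,\mu)=0,\ \mu^{\mathtt T}g(x^*)=0\}$$ be the set of Lagrange multipliers at $x^*$. Assume: 1. (MFCQ) The vectors $\nabla h_i(x^*)$, $1\le i\le m$, are linearly independent, and there is $d\in\mathbb{R}^n$ with $\nabla h_i(x^*)^{\mathtt T}d=0$ for all $i$ and $\nabla g_j(x^*)^{\mathtt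 T}d<0$ for all $j\in A$. 2. (Rank) With $r=\operatorname{rank}J(x^*)$, one has $\operatorname{rank}J(x)\le r+1$ for all $x$ in some neighborhood of $x^*$. 3. (Smooth SVD) There are matrix functions $U(x)\in\mathbb{R}^{(m+q)\times(m+q)}$, $\Sigma(x)\in\mathbb{R}^{(m+q)\times n}$, $V(x)\in\mathbb{R}^{n\times n}$, differentiable in a neighborhood of $x^*$, such that for all $x$ in this neighborhood $J(x)=U(x)\Sigma(x)V(x)^{\mathtt T}$, where $\Sigma(x)$ is diagonal with diagonal entries $\sigma_1(x),\dots,\sigma_{\min\{m+q,n\}}(x)$ and $\sigma_i(x)=0$ whenever $i>\operatorname{rank}J(x)$; moreover, the columns of $U(x^*)$ are nonzero and pairwise orthogonal, and so are the columns of $V(x^*)$. 4. (Generalized strict complementary slackness) There is at most one index $j\in A$ such that $\mu_j=0$ for every $(\lambda,\mu)\in\Lambda(x^*)$. Then the strong second-order optimality condition (SSOC) holds at $x^*$: there is a single multiplier $(\lambda,\mu)\in\Lambda(x^*)$ such that $$d^{\mathtt T}\nabla^2_{xx}L(x^*,\lambda,\mu)\,d\ge 0\quad\text{for every } d\in C(x^*),$$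 where $C(x^*)=\{d\in\mathbb{R}^n: \nabla f(x^*)^{\mathtt T}d=0,\ \nabla h_i(x^*)^{\mathtt T}d=0\ \forall i,\ \nabla g_j(x^*)^{\mathtt T}d\le 0\ \forall j\in A\}$ is the critical cone. -/

import Mathlib

open Topology

noncomputable section

/-- Data of the problem: minimize `f x` subject to `h i x = 0` (`i : Fin m`) and
`g j x ≤ 0` (`j : Fin p`), over `x` in `ℝⁿ`. -/
structure NLP (n m p : ℕ) where
  f : EuclideanSpace ℝ (Fin n) → ℝ
  h : Fin m → EuclideanSpace ℝ (Fin n) → ℝ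
  g : Fin p → EuclideanSpace ℝ (Fin n) → ℝ

namespace NLP

/-- All the functions of the problem are twice continuously differentiable. -/
def IsC2 {n m p : ℕ} (P : NLP n m p) : Prop :=
  ContDiff ℝ 2 P.f ∧ (∀ i, ContDiff ℝ 2 (P.h i)) ∧ (∀ j, ContDiff ℝ 2 (P.g j))

/-- The feasible set `Ω`. -/
def feasible {n m p : ℕ} (P : NLP n m p) : Set (EuclideanSpace ℝ (Fin n)) :=
  {x | (∀ i, P.h i x = 0) ∧ (∀ j, P.g j x ≤ 0)}

/-- `xs` is a feasible point at which `f` is minimal over the feasible points near `xs`. -/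
def IsLocalMinimizer {n m p : ℕ} (P : NLP n m p) (xs : EuclideanSpace ℝ (Fin n)) : Prop :=
  xs ∈ P.feasible ∧ IsLocalMinOn P.f P.feasible xs

/-- The set `A(x)` of indices of active inequalities. -/
def active {n m p : ℕ} (P : NLP n m p) (x : EuclideanSpace ℝ (Fin n)) : Set (Fin p) :=
  {j | P.g j x = 0}

instance {n m p : ℕ} (P : NLP n m p) (x : EuclideanSpace ℝ (Fin n)) : Fintype (P.active x) :=
  Fintype.ofFinite _

/-- The number `q` of active inequalities at `x`. -/
def numActive {n m p : ℕ} (P : NLP n m p) (x : EuclideanSpace ℝ (Fin n)) : ℕ :=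
  (P.active x).ncard

/-- The Mangasarian-Fromovitz constraint qualification at `x`. -/
def MFCQ {n m p : ℕ} (P : NLP n m p) (x : EuclideanSpace ℝ (Fin n)) : Prop :=
  LinearIndependent ℝ (fun i => gradient (P.h i) x) ∧
    ∃ d : EuclideanSpace ℝ (Fin n),
      (∀ i, inner ℝ (gradient (P.h i) x) d = 0) ∧
      (∀ j ∈ P.active x, inner ℝ (gradient (P.g j) x) d < 0)

/-- The Jacobian `J(x)`: its rows are the gradients at `x` of the equality constraints and of the
inequality constraints that are active at the base point `xs`. -/
def jacobian {n m p : ℕ} (P : NLP n m p) (xs x : EuclideanSpace ℝ (Fin n)) :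
    Matrix (Fin m ⊕ P.active xs) (Fin n) ℝ :=
  Matrix.of (Sum.elim (fun i k => gradient (P.h i) x k) (fun j k => gradient (P.g j) x k))

/-- The rank of `J(x)` is at most `r + 1` for `x` near `xs`, where `r` is the rank of `J(xs)`. -/
def RankIncreasesAtMostOne {n m p : ℕ} (P : NLP n m p) (xs : EuclideanSpace ℝ (Fin n)) : Prop :=
  ∀ᶠ x in 𝓝 xs, (P.jacobian xs x).rank ≤ (P.jacobian xs xs).rank + 1

/-- Existence of a smooth (weak) singular value decomposition `J(x) = U(x) Σ(x) V(x)ᵀ` near `xs`.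
The rows of `U` are indexed like those of `J`, and its `m + q` columns by `Fin (m + q)`; so `U` is a
square matrix up to the labelling of its rows. The diagonal entries `σ₁, σ₂, …` of `Σ` have the
zero-based indices `0, 1, …`, hence `σ_{i+1}(x) = 0` is required when `rank J(x) < i + 1`. -/
def HasSmoothSVD {n m p : ℕ} (P : NLP n m p) (xs : EuclideanSpace ℝ (Fin n)) : Prop :=
  ∃ (U : EuclideanSpace ℝ (Fin n) →
        Matrix (Fin m ⊕ P.active xs) (Fin (m + P.numActive xs)) ℝ)
    (S : EuclideanSpace ℝ (Fin n) → Matrix (Fin (m + P.numActive xs)) (Fin n) ℝ)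
    (V : EuclideanSpace ℝ (Fin n) → Matrix (Fin n) (Fin n) ℝ),
    (∀ᶠ x in 𝓝 xs,
      (∀ i k, DifferentiableAt ℝ (fun y => U y i k) x) ∧
      (∀ i k, DifferentiableAt ℝ (fun y => S y i k) x) ∧
      (∀ i k, DifferentiableAt ℝ (fun y => V y i k) x) ∧
      P.jacobian xs x = U x * S x * (V x).transpose ∧
      (∀ i k, i.val ≠ k.val → S x i k = 0) ∧
      (∀ i k, i.val = k.val → (P.jacobian xs x).rank < i.val + 1 → S x i k = 0)) ∧
    (∀ k, (U xs).col k ≠ 0) ∧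
    (∀ k l, k ≠ l → (U xs).col k ⬝ᵥ (U xs).col l = 0) ∧
    (∀ k, (V xs).col k ≠ 0) ∧
    (∀ k l, k ≠ l → (V xs).col k ⬝ᵥ (V xs).col l = 0)

/-- The Lagrangian `L(x, lam, mu)`. -/
def lagrangian {n m p : ℕ} (P : NLP n m p) (lam : Fin m → ℝ) (mu : Fin p → ℝ)
    (x : EuclideanSpace ℝ (Fin n)) : ℝ :=
  P.f x + ∑ i, lam i * P.h i x + ∑ j, mu j * P.g j x

/-- The set `Λ(x)` of Lagrange multipliers. -/
def multipliers {n m p : ℕ} (P : NLP n m p) (x : EuclideanSpace ℝ (Fin n)) :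
    Set ((Fin m → ℝ) × (Fin p → ℝ)) :=
  {q | gradient (P.lagrangian q.1 q.2) x = 0 ∧ (∀ j, 0 ≤ q.2 j) ∧ ∑ j, q.2 j * P.g j x = 0}

/-- The critical cone `C(x)`. -/
def criticalCone {n m p : ℕ} (P : NLP n m p) (x : EuclideanSpace ℝ (Fin n)) :
    Set (EuclideanSpace ℝ (Fin n)) :=
  {d | inner ℝ (gradient P.f x) d = 0 ∧ (∀ i, inner ℝ (gradient (P.h i) x) d = 0) ∧
    (∀ j ∈ P.active x, inner ℝ (gradient (P.g j) x) d ≤ 0)}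

/-- Generalized strict complementary slackness: at most one active index `j` is such that `mu j`
vanishes for all Lagrange multipliers `(lam, mu)`. -/
def GSCS {n m p : ℕ} (P : NLP n m p) (x : EuclideanSpace ℝ (Fin n)) : Prop :=
  {j | j ∈ P.active x ∧ ∀ q ∈ P.multipliers x, q.2 j = 0}.Subsingleton

/-- The strong second-order optimality condition: for a single Lagrange multiplier, the Hessian
quadratic form of the Lagrangian in `x` is nonnegative on the whole critical cone. -/
def SSOC {n m p : ℕ} (P : NLP n m p) (x : EuclideanSpace ℝ (Fin n)) : Prop :=
  ∃ q ∈ P.multipliers x, ∀ d ∈ P.criticalCone x,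
    0 ≤ fderiv ℝ (fderiv ℝ (P.lagrangian q.1 q.2)) x d d

end NLP

end

/-!
Write `A` for the set of active inequalities and `J` for the Jacobian at `x*`. An active inequality
is called *rigid* if its gradient is orthogonal to the whole critical cone `C`. Every multiplier is
supported on the rigid inequalities, so by generalized strict complementarity all of `A` but at most
one index is rigid, and the tangent space `T` of the equalities and rigid inequalities is `C ∪ -C`.
It has the form `T = (T ∩ ker J) + ℝ d₀`.

*Duality.* Moving along second-order arcs `x* + t d + (t² / 2) z + o(t²)`, corrected to satisfy the
equalities by metric regularity, shows that for a critical `d` no `z` solves the second-order system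
`∇h z + dᵀ∇²h d = 0`, `∇g z + dᵀ∇²g d < 0`, `∇f z + dᵀ∇²f d < 0`. If the second-order data
`(dᵀ∇²h d, dᵀ∇²g d, dᵀ∇²f d)` of a family of directions form a convex set, modulo the first-order
terms in `z` and up to increasing the inequality and objective parts, the separation theorem yields
one multiplier for all `d` in the family; its objective component is nonzero by MFCQ
(`NLP.IsLocalMinimizer.exists_multiplier`). It remains to prove this convexity for the family `T`,
that is, that for `d₁, d₂ ∈ T` there is `d ∈ T` such that `Q_w(d) = Q_w(d₁) + Q_w(d₂)` for all `w`
in the left kernel of the rigid rows, `Q_w` being the corresponding combination of constraint Hessians,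
and `Q(d) ≤ Q(d₁) + Q(d₂)` for the Hessian `Q` of the Lagrangian at one fixed multiplier.

*The forms `Q_w`.* Differentiating `J(x) = ∑ σᵢ(x) uᵢ(x) vᵢ(x)ᵀ` at `x*` and testing with `w` in the
left kernel and `y ∈ ker J`, only the one term whose `σᵢ` vanishes at `x*` but possibly not nearby
survives, so `B_w(d, y) = α(w) ℓ(d) ⟪v, y⟫` with `v ∈ ker J`, for all `d`
(`exists_rank_one_of_smooth_svd`). By symmetry of second derivatives, `ℓ` is a multiple
`κ ⟪v, ·⟫` on `ker J`, unless all `α(w) v` vanish. Hence for `d = y + s d₀` in `T` the form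
`Q_w(d)` equals `α(w) (κ ⟪v, y⟫² + 2 ρ s ⟪v, y⟫) + β(w) s²`, with `ρ = ℓ(d₀)`.

*Hidden convexity.* If `κ ≠ 0`, completing the square makes all `Q_w` combinations of two squares
`a²`, `s²` of linear functionals, and `exists_add_sq_add_sq_and_le` provides `d` for any third form
`Q`. If `κ = 0`, rotate `(d₁, d₂)` into `(e₁, e₂)` with `s(e₂) = 0`; then all `Q_w(e₂)` vanish, the
second-order condition for the single direction `e₂` gives `Q(e₂) ≥ 0`, and `d = e₁` works.
-/

noncomputable section

/-! ### Solvability of linear systems -/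

theorem LinearMap.pi_eq_sum {ι : Type*} [Fintype ι] [DecidableEq ι] (φ : (ι → ℝ) →ₗ[ℝ] ℝ)
    (y : ι → ℝ) : φ y = ∑ i, φ (Pi.single i 1) * y i := by
  conv_lhs => rw [← Finset.univ_sum_single y]
  rw [map_sum]
  refine Finset.sum_congr rfl fun i _ => ?_
  rw [mul_comm, ← smul_eq_mul, ← map_smul, ← Pi.single_smul, smul_eq_mul, mul_one]

/-- The Fredholm alternative for a finite linear system. -/
theorem exists_eq_of_forall_left_ker {E ι : Type*} [NormedAddCommGroup E] [NormedSpace ℝ E]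
    [Fintype ι] (c : ι → E →L[ℝ] ℝ) (b : ι → ℝ)
    (h : ∀ w : ι → ℝ, (∀ z, ∑ i, w i * c i z = 0) → ∑ i, w i * b i = 0) :
    ∃ z, ∀ i, c i z = b i := by
  classical
  set M : E →ₗ[ℝ] (ι → ℝ) := LinearMap.pi fun i => (c i : E →ₗ[ℝ] ℝ)
  suffices hb : b ∈ LinearMap.range M by
    obtain ⟨z, hz⟩ := hb
    exact ⟨z, fun i => congrFun hz i⟩
  by_contra hb
  obtain ⟨φ, hφ, hker⟩ := Submodule.exists_le_ker_of_notMem hb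
  refine hφ ?_
  rw [φ.pi_eq_sum]
  refine h _ fun z => ?_
  have : φ (M z) = 0 := hker ⟨z, rfl⟩
  rwa [φ.pi_eq_sum] at this

theorem LinearIndependent.surjective_inner {E ι : Type*} [NormedAddCommGroup E]
    [InnerProductSpace ℝ E] [Fintype ι] {v : ι → E} (hv : LinearIndependent ℝ v) :
    Function.Surjective (fun d : E => fun i => inner ℝ (v i) d) := by
  intro b
  obtain ⟨z, hz⟩ := exists_eq_of_forall_left_ker (fun i => innerSL ℝ (v i)) b fun w hw => by
    have hsum : ∑ i, w i • v i = 0 := ext_inner_right ℝ fun d => by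
      rw [sum_inner, inner_zero_left, ← hw d]
      exact Finset.sum_congr rfl fun i _ => real_inner_smul_left _ _ _
    simp [Fintype.linearIndependent_iff.1 hv w hsum]
  exact ⟨z, funext hz⟩

/-! ### Second-order expansions along curves in the feasible set -/

theorem ContDiff.taylor_two_isLittleO {E : Type*} [NormedAddCommGroup E] [NormedSpace ℝ E]
    {φ : E → ℝ} (hφ : ContDiff ℝ 2 φ) (a : E) :
    (fun x => φ x - φ a - fderiv ℝ φ a (x - a)
      - (1 / 2 : ℝ) * fderiv ℝ (fderiv ℝ φ) a (x - a) (x - a)) =o[𝓝 a] fun x => ‖x - a‖ ^ 2 := by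
  set D := fderiv ℝ φ a with hD
  set B := fderiv ℝ (fderiv ℝ φ) a with hB
  have hsymm : ∀ v w, B v w = B w v := fun v w =>
    (hφ.contDiffAt.isSymmSndFDerivAt (by simp)).eq v w
  have hd : ∀ x, HasFDerivAt φ (fderiv ℝ φ x) x := fun x =>
    (hφ.differentiable (by simp) x).hasFDerivAt
  have hdd : HasFDerivAt (fderiv ℝ φ) B a :=
    ((hφ.fderiv_right (m := 1) (by norm_num)).differentiable (by simp) a).hasFDerivAt
  have hg : ∀ x ∈ Set.univ, HasFDerivWithinAt
      (fun x => φ x - D (x - a) - (1 / 2 : ℝ) * B (x - a) (x - a))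
      (fderiv ℝ φ x - D - B (x - a)) Set.univ x := by
    intro x _
    rw [hasFDerivWithinAt_univ]
    have h1 : HasFDerivAt (fun x : E => x - a) (ContinuousLinearMap.id ℝ E) x :=
      (hasFDerivAt_id x).sub_const a
    have h2 : HasFDerivAt (fun x => D (x - a)) D x := 
      (D.hasFDerivAt.comp x h1).congr_fderiv (ContinuousLinearMap.comp_id _)
    have h3 : HasFDerivAt (fun x => B (x - a)) B x := 
      (B.hasFDerivAt.comp x h1).congr_fderiv (ContinuousLinearMap.comp_id _)
    have h4 := (h3.clm_apply h1).const_mul (1 / 2 : ℝ)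
    refine (((hd x).sub h2).sub h4).congr_fderiv ?_
    ext v
    simp [hsymm v x, hsymm v a]
    ring
  have ho : (fun x => fderiv ℝ φ x - D - B (x - a)) =o[𝓝[Set.univ] a] fun x => ‖x - a‖ ^ 1 := by
    simpa using (hasFDerivAt_iff_isLittleO.1 hdd).norm_right
  have := convex_univ.isLittleO_pow_succ (Set.mem_univ a) hg ho
  simp only [nhdsWithin_univ] at this
  refine this.congr_left fun x => ?_
  simp
  ring

/-- The expansion of a `C²` function along a curve `t ↦ a + t d + (t² / 2) z + o(t²)`. -/
theorem ContDiff.isLittleO_comp_arc {E : Type*} [NormedAddCommGroup E] [NormedSpace ℝ E]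
    {φ : E → ℝ} (hφ : ContDiff ℝ 2 φ) {a d z : E} {γ : ℝ → E}
    (hγ : (fun t => γ t - (a + t • d + (t ^ 2 / 2) • z)) =o[𝓝[>] (0 : ℝ)] fun t => t ^ 2) :
    (fun t => φ (γ t) - φ a - t * fderiv ℝ φ a d
      - t ^ 2 / 2 * (fderiv ℝ φ a z + fderiv ℝ (fderiv ℝ φ) a d d))
      =o[𝓝[>] (0 : ℝ)] fun t => t ^ 2 := by
  set D := fderiv ℝ φ a with hD
  set B := fderiv ℝ (fderiv ℝ φ) a with hB
  have ht : Filter.Tendsto (fun t : ℝ => t) (𝓝[>] 0) (𝓝 0) :=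
    Filter.tendsto_id.mono_left inf_le_left
  have ht1 : (fun t : ℝ => t ^ 2) =o[𝓝[>] (0 : ℝ)] fun t => t := by
    simpa [sq] using (Asymptotics.isBigO_refl (fun t : ℝ => t) (𝓝[>] 0)).mul_isLittleO
      ((Asymptotics.isLittleO_one_iff ℝ).2 ht)
  -- `γ t - a` is split as `t • d + e t`, where the remainder `e` is `O(t²)`.
  have he : (fun t => γ t - a - t • d) =O[𝓝[>] (0 : ℝ)] fun t => t ^ 2 := by
    have h2 : (fun t : ℝ => (t ^ 2 / 2) • z) =O[𝓝[>] (0 : ℝ)] fun t => t ^ 2 := by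
      refine Asymptotics.IsBigO.of_bound (‖z‖) (Filter.Eventually.of_forall fun t => ?_)
      rw [norm_smul, norm_div, Real.norm_ofNat]
      nlinarith [norm_nonneg z, norm_nonneg (t ^ 2), mul_nonneg (norm_nonneg z) (norm_nonneg (t^2))]
    refine (hγ.isBigO.add h2).congr_left fun t => ?_
    abel
  have hd : (fun t : ℝ => t • d) =O[𝓝[>] (0 : ℝ)] fun t => t :=
    Asymptotics.IsBigO.of_bound (‖d‖) (Filter.Eventually.of_forall fun t => by
      rw [norm_smul, mul_comm])
  have he1 : (fun t => γ t - a - t • d) =o[𝓝[>] (0 : ℝ)] fun t => t := he.trans_isLittleO ht1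
  have hγa : (fun t => γ t - a) =O[𝓝[>] (0 : ℝ)] fun t => t :=
    (he1.isBigO.add hd).congr_left fun t => by abel
  have hlim : Filter.Tendsto γ (𝓝[>] (0 : ℝ)) (𝓝 a) := by
    have := hγa.trans_tendsto ht
    simpa using this.add_const a
  have h1 := (hφ.taylor_two_isLittleO a).comp_tendsto hlim
  have h1' : (fun t => φ (γ t) - φ a - D (γ t - a) - (1 / 2 : ℝ) * B (γ t - a) (γ t - a))
      =o[𝓝[>] (0 : ℝ)] fun t => t ^ 2 :=
    h1.trans_isBigO (by simpa [Function.comp_def] using hγa.norm_left.pow 2)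
  have h2 : (fun t => D (γ t - (a + t • d + (t ^ 2 / 2) • z))) =o[𝓝[>] (0 : ℝ)] fun t => t ^ 2 :=
    (D.isBigO_comp _ _).trans_isLittleO hγ
  have hBO : ∀ {u v : ℝ → E} {p q : ℝ → ℝ}, u =O[𝓝[>] (0 : ℝ)] p → v =o[𝓝[>] (0 : ℝ)] q →
      (fun t => B (u t) (v t)) =o[𝓝[>] (0 : ℝ)] fun t => p t * q t := by
    intro u v p q hu hv
    have : (fun t => B (u t) (v t)) =O[𝓝[>] (0 : ℝ)] fun t => ‖u t‖ * ‖v t‖ := by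
      refine Asymptotics.IsBigO.of_bound (‖B‖) (Filter.Eventually.of_forall fun t => ?_)
      simpa [mul_assoc] using B.le_opNorm₂ (u t) (v t)
    exact this.trans_isLittleO (hu.norm_left.mul_isLittleO hv.norm_left)
  have hsymm : ∀ v w, B v w = B w v := fun v w =>
    (hφ.contDiffAt.isSymmSndFDerivAt (by simp)).eq v w
  have h3 : (fun t => B (γ t - a) (γ t - a - t • d)) =o[𝓝[>] (0 : ℝ)] fun t => t ^ 2 := by
    simpa [sq] using hBO hγa he1
  have h4 : (fun t => B (t • d) (γ t - a - t • d)) =o[𝓝[>] (0 : ℝ)] fun t => t ^ 2 := by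
    simpa [sq] using hBO hd he1
  have h5 := ((h1'.add h2).add (h3.const_mul_left (1 / 2))).add (h4.const_mul_left (1 / 2))
  refine h5.congr_left fun t => ?_
  have e1 : D (γ t - (a + t • d + (t ^ 2 / 2) • z))
      = D (γ t - a) - t * D d - t ^ 2 / 2 * D z := by
    simp only [map_sub, map_add, map_smul, smul_eq_mul]
    ring
  have e2 : B (γ t - a) (γ t - a - t • d) + B (t • d) (γ t - a - t • d)
      = B (γ t - a) (γ t - a) - t ^ 2 * B d d := by
    have := hsymm (γ t - a) d
    simp only [map_sub, map_smul, smul_eq_mul, sub_apply,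
      smul_apply] at this ⊢
    linear_combination -t * this
  rw [e1]
  linear_combination (1 / 2) * e2

/-- Metric regularity: near a point at which the derivative is onto, the distance to the zero set
is at most a multiple of the norm of the value. -/
theorem HasStrictFDerivAt.exists_zero_near {E F : Type*} [NormedAddCommGroup E] [NormedSpace ℝ E]
    [CompleteSpace E] [NormedAddCommGroup F] [NormedSpace ℝ F] [CompleteSpace F]
    {h : E → F} {M : E →L[ℝ] F} {a : E} (hh : HasStrictFDerivAt h M a)
    (hM : Function.Surjective M) (ha : h a = 0) :
    ∃ K : ℝ, ∀ᶠ x in 𝓝 a, ∃ y, h y = 0 ∧ ‖y - x‖ ≤ K * ‖h x‖ := by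
  have hr : (M : E →ₗ[ℝ] F).range = ⊤ := LinearMap.range_eq_top.2 hM
  set R := M.nonlinearRightInverseOfSurjective hr
  have hR : 0 < R.nnnorm := M.nonlinearRightInverseOfSurjective_nnnorm_pos hr
  set c : NNReal := R.nnnorm⁻¹ / 2 with hc
  have hc0 : 0 < c := by positivity
  obtain ⟨s, hs, hs'⟩ := hh.approximates_deriv_on_nhds (c := c) (Or.inr hc0)
  obtain ⟨ε, hε, hball⟩ := Metric.mem_nhds_iff.1 hs
  have hcR : ((R.nnnorm : ℝ)⁻¹ - c) = c := by
    rw [hc]; push_cast; ring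
  have hcpos : (0 : ℝ) < c := hc0
  have hcont : Filter.Tendsto (fun x => (c : ℝ)⁻¹ * ‖h x‖) (𝓝 a) (𝓝 0) := by
    have : Filter.Tendsto (fun x => (c : ℝ)⁻¹ * ‖h x‖) (𝓝 a) (𝓝 ((c : ℝ)⁻¹ * ‖h a‖)) :=
      (hh.continuousAt.norm).const_mul _
    simpa [ha] using this
  refine ⟨(c : ℝ)⁻¹, ?_⟩
  filter_upwards [hcont.eventually (gt_mem_nhds (half_pos hε)),
    Metric.ball_mem_nhds a (half_pos hε)] with x hx1 hx2
  have hsub : Metric.closedBall x ((c : ℝ)⁻¹ * ‖h x‖) ⊆ s := by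
    refine Set.Subset.trans (fun y hy => ?_) hball
    rw [Metric.mem_ball] at hx2 ⊢
    rw [Metric.mem_closedBall] at hy
    linarith [dist_triangle y x a]
  have := hs'.surjOn_closedBall_of_nonlinearRightInverse R (by positivity) hsub
  rw [hcR, mul_inv_cancel_left₀ hcpos.ne'] at this
  obtain ⟨y, hy, hy0⟩ := this (show (0 : F) ∈ _ by simp [Metric.mem_closedBall])
  exact ⟨y, hy0, by simpa [Metric.mem_closedBall, dist_eq_norm] using hy⟩

theorem eventually_neg_of_expansion {F : ℝ → ℝ} {A B : ℝ}
    (hF : (fun t => F t - t * A - t ^ 2 / 2 * B) =o[𝓝[>] (0 : ℝ)] fun t => t ^ 2)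
    (hAB : A < 0 ∨ A = 0 ∧ B < 0) : ∀ᶠ t in 𝓝[>] (0 : ℝ), F t < 0 := by
  have hpos : ∀ᶠ t in 𝓝[>] (0 : ℝ), 0 < t := self_mem_nhdsWithin
  rcases hAB with hA | ⟨rfl, hB⟩
  · have hlim : Filter.Tendsto (fun t : ℝ => t * (|B| / 2 + 1)) (𝓝[>] 0) (𝓝 0) := by
      have : Filter.Tendsto (fun t : ℝ => t * (|B| / 2 + 1)) (𝓝 0) (𝓝 (0 * (|B| / 2 + 1))) :=
        Filter.tendsto_id.mul_const _
      rw [zero_mul] at this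
      exact this.mono_left inf_le_left
    filter_upwards [hpos, hF.bound one_pos, hlim.eventually (gt_mem_nhds (neg_pos.2 hA))]
      with t ht hb hs
    rw [Real.norm_eq_abs, Real.norm_eq_abs, abs_of_pos (pow_pos ht 2)] at hb
    have h1 := (abs_le.1 hb).2
    have h2 : t ^ 2 / 2 * B ≤ t ^ 2 / 2 * |B| := by gcongr; exact le_abs_self B
    have h3 : t * (t * (|B| / 2 + 1)) < t * (-A) := by gcongr
    nlinarith
  · filter_upwards [hpos, hF.bound (show (0 : ℝ) < -B / 4 by linarith)] with t ht hb
    rw [Real.norm_eq_abs, Real.norm_eq_abs, abs_of_pos (pow_pos ht 2)] at hb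
    have h1 := (abs_le.1 hb).2
    nlinarith [mul_pos (pow_pos ht 2) (neg_pos.2 hB)]

namespace NLP

variable {n m p : ℕ} {P : NLP n m p} {xs : EuclideanSpace ℝ (Fin n)}

theorem MFCQ.surjective_fderiv (hM : P.MFCQ xs) :
    Function.Surjective (ContinuousLinearMap.pi fun i => fderiv ℝ (P.h i) xs) := by
  convert hM.1.surjective_inner using 1
  ext d i
  simp [inner_gradient_left]

/-- The primal second-order necessary condition: no second-order correction `z` of a critical
direction `d` is feasible to second order and decreases `f`. -/
theorem IsLocalMinimizer.second_order_primal (hmin : P.IsLocalMinimizer xs) (hP : P.IsC2)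
    (hM : P.MFCQ xs) {d z : EuclideanSpace ℝ (Fin n)} (hd : d ∈ P.criticalCone xs)
    (hh : ∀ i, fderiv ℝ (P.h i) xs z + fderiv ℝ (fderiv ℝ (P.h i)) xs d d = 0)
    (hg : ∀ j ∈ P.active xs, fderiv ℝ (P.g j) xs d = 0 →
      fderiv ℝ (P.g j) xs z + fderiv ℝ (fderiv ℝ (P.g j)) xs d d < 0) :
    0 ≤ fderiv ℝ P.f xs z + fderiv ℝ (fderiv ℝ P.f) xs d d := by
  obtain ⟨hf2, hh2, hg2⟩ := hP
  obtain ⟨⟨hxh, hxg⟩, hloc⟩ := hmin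
  obtain ⟨hdf, hdh, hdg⟩ := hd
  simp only [inner_gradient_left] at hdf hdh hdg
  by_contra! hneg
  set H : EuclideanSpace ℝ (Fin n) → Fin m → ℝ := fun x i => P.h i x with hH
  have hHs : HasStrictFDerivAt H (ContinuousLinearMap.pi fun i => fderiv ℝ (P.h i) xs) xs :=
    hasStrictFDerivAt_pi.2 fun i => (hh2 i).hasStrictFDerivAt (by simp)
  obtain ⟨K, hK⟩ := hHs.exists_zero_near hM.surjective_fderiv (funext hxh)
  obtain ⟨e, he⟩ := hK.choice
  set x : ℝ → EuclideanSpace ℝ (Fin n) := fun t => xs + t • d + (t ^ 2 / 2) • z with hx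
  have hxlim : Filter.Tendsto x (𝓝[>] 0) (𝓝 xs) := by
    have : ContinuousAt x 0 := by fun_prop
    have h0 : x 0 = xs := by simp [hx]
    rw [ContinuousAt, h0] at this
    exact this.mono_left inf_le_left
  have hHo : (fun t => H (x t)) =o[𝓝[>] (0 : ℝ)] fun t => t ^ 2 := by
    refine Asymptotics.isLittleO_pi.2 fun i => ?_
    have := (hh2 i).isLittleO_comp_arc (a := xs) (d := d) (z := z) (γ := x) (by simp [hx])
    simpa [hxh, hdh, hh] using this
  have hex := hxlim.eventually he
  set γ : ℝ → EuclideanSpace ℝ (Fin n) := fun t => e (x t) with hγ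
  have hγo : (fun t => γ t - (xs + t • d + (t ^ 2 / 2) • z)) =o[𝓝[>] (0 : ℝ)] fun t => t ^ 2 :=
    (Asymptotics.IsBigO.of_bound K (hex.mono fun t ht => ht.2)).trans_isLittleO hHo
  have hγlim : Filter.Tendsto γ (𝓝[>] 0) (𝓝 xs) := by
    have h1 : Filter.Tendsto (fun t : ℝ => t ^ 2) (𝓝[>] 0) (𝓝 0) := by
      have : Filter.Tendsto (fun t : ℝ => t ^ 2) (𝓝 0) (𝓝 (0 ^ 2)) := (continuous_pow 2).tendsto 0
      rw [zero_pow two_ne_zero] at this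
      exact this.mono_left inf_le_left
    have := (hγo.isBigO.trans_tendsto h1).add hxlim
    rw [zero_add] at this
    exact this.congr fun t => by simp [hx]
  have hgneg : ∀ j, ∀ᶠ t in 𝓝[>] (0 : ℝ), P.g j (γ t) < 0 := by
    intro j
    rcases (hxg j).lt_or_eq with hj | hj
    · exact (((hg2 j).continuous.tendsto xs).comp hγlim).eventually (gt_mem_nhds hj)
    · have h1 := (hg2 j).isLittleO_comp_arc hγo
      simp only [hj, sub_zero] at h1
      refine eventually_neg_of_expansion h1 ?_
      rcases (hdg j hj).lt_or_eq with h | h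
      · exact Or.inl h
      · exact Or.inr ⟨h, hg j hj h⟩
  have hfneg : ∀ᶠ t in 𝓝[>] (0 : ℝ), P.f (γ t) - P.f xs < 0 :=
    eventually_neg_of_expansion (hf2.isLittleO_comp_arc hγo) (Or.inr ⟨hdf, hneg⟩)
  have hfpos : ∀ᶠ t in 𝓝[>] (0 : ℝ), γ t ∈ P.feasible → P.f xs ≤ P.f (γ t) :=
    hγlim.eventually (eventually_nhdsWithin_iff.1 hloc)
  obtain ⟨t, h1, h2, h3, h4⟩ :=
    (hex.and ((Filter.eventually_all.2 hgneg).and (hfneg.and hfpos))).exists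
  have := h4 ⟨fun i => congrFun h1.1 i, fun j => (h2 j).le⟩
  linarith

end NLP

/-! ### A theorem of the alternative -/

theorem nonneg_and_nonneg_of_forall_pos {A B : ℝ} (h : ∀ t : ℝ, 0 < t → 0 < A + t * B) :
    0 ≤ A ∧ 0 ≤ B := by
  constructor
  · by_contra! hA
    have hB : 0 < B := by have := h 1 one_pos; linarith
    have := h (-A / (2 * B)) (by apply div_pos <;> linarith)
    rw [show -A / (2 * B) * B = -A / 2 by field_simp] at this
    linarith
  · by_contra! hB
    have hA : 0 < A := by have := h 1 one_pos; linarith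
    have := h (A / (-B)) (by apply div_pos <;> linarith)
    rw [div_neg, neg_mul, div_mul_cancel₀ A hB.ne] at this
    linarith

/-- A theorem of the alternative of Motzkin type for a family of inhomogeneous systems
`a z + p x = 0`, `b z + q x < 0`, `c z + r x < 0` in the unknown `z`, indexed by `x`. If no member
of the family is solvable and the family is convex up to a change of `z`, then a single multiplier
certifies this for all `x` at once. -/
theorem exists_multiplier_of_infeasible {E ι κ X : Type*} [NormedAddCommGroup E]
    [NormedSpace ℝ E] [Fintype ι] [Fintype κ] [Nonempty X]
    (a : E →L[ℝ] (ι → ℝ)) (b : E →L[ℝ] (κ → ℝ)) (c : E →L[ℝ] ℝ) (ha : Function.Surjective a)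
    (p : X → ι → ℝ) (q : X → κ → ℝ) (r : X → ℝ)
    (hconv : ∀ x₁ x₂ (s t : ℝ), 0 < s → 0 < t → s + t = 1 → ∃ x z,
      a z + p x = s • p x₁ + t • p x₂ ∧ b z + q x ≤ s • q x₁ + t • q x₂ ∧
      c z + r x ≤ s * r x₁ + t * r x₂)
    (hinf : ∀ x z, a z + p x = 0 → (∀ j, (b z + q x) j < 0) → 0 ≤ c z + r x) :
    ∃ (lam : ι → ℝ) (mu : κ → ℝ) (mu₀ : ℝ), (∀ j, 0 ≤ mu j) ∧ 0 ≤ mu₀ ∧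
      ¬(lam = 0 ∧ mu = 0 ∧ mu₀ = 0) ∧
      (∀ z, ∑ i, lam i * a z i + ∑ j, mu j * b z j + mu₀ * c z = 0) ∧
      ∀ x, 0 ≤ ∑ i, lam i * p x i + ∑ j, mu j * q x j + mu₀ * r x := by
  classical
  obtain ⟨R₀, hR₀⟩ := (a : E →ₗ[ℝ] (ι → ℝ)).exists_rightInverse_of_surjective
    (LinearMap.range_eq_top.2 ha)
  set R : (ι → ℝ) →L[ℝ] E := R₀.toContinuousLinearMap
  have hR : ∀ y, a (R y) = y := fun y => LinearMap.congr_fun hR₀ y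
  set K : Set ((ι → ℝ) × (κ → ℝ) × ℝ) :=
    {w | ∃ x z, w.1 = a z + p x ∧ (∀ j, b z j + q x j < w.2.1 j) ∧ c z + r x < w.2.2} with hK
  have hopen : IsOpen K := by
    rw [isOpen_iff_mem_nhds]
    rintro w ⟨x, z, h1, h2, h3⟩
    -- A perturbation of the equality part is absorbed by moving `z` along the right inverse `R`.
    set ζ : (ι → ℝ) × (κ → ℝ) × ℝ → E := fun w' => z + R (w'.1 - w.1) with hζ
    have hζc : Continuous ζ := by fun_prop
    have hζw : ζ w = z := by simp [hζ]
    have e2 : ∀ j, ∀ᶠ w' in 𝓝 w, b (ζ w') j + q x j < w'.2.1 j := fun j => by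
      have hl : Continuous fun w' => b (ζ w') j + q x j := by fun_prop
      have hr : Continuous fun w' : (ι → ℝ) × (κ → ℝ) × ℝ => w'.2.1 j := by fun_prop
      exact hl.continuousAt.eventually_lt hr.continuousAt (by rw [hζw]; exact h2 j)
    have e3 : ∀ᶠ w' in 𝓝 w, c (ζ w') + r x < w'.2.2 := by
      have hl : Continuous fun w' => c (ζ w') + r x := by fun_prop
      have hr : Continuous fun w' : (ι → ℝ) × (κ → ℝ) × ℝ => w'.2.2 := by fun_prop
      exact hl.continuousAt.eventually_lt hr.continuousAt (by rw [hζw]; exact h3)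
    filter_upwards [Filter.eventually_all.2 e2, e3] with w' h2' h3'
    refine ⟨x, ζ w', ?_, h2', h3'⟩
    simp only [hζ, map_add, hR, h1]
    abel
  have hconvex : Convex ℝ K := by
    rw [convex_iff_forall_pos]
    rintro w₁ ⟨x₁, z₁, h11, h12, h13⟩ w₂ ⟨x₂, z₂, h21, h22, h23⟩ s t hs ht hst
    obtain ⟨x, z, hp, hq, hr⟩ := hconv x₁ x₂ s t hs ht hst
    refine ⟨x, s • z₁ + t • z₂ + z, ?_, fun j => ?_, ?_⟩
    · rw [map_add, add_assoc, hp]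
      simp only [Prod.fst_add, Prod.smul_fst, h11, h21, map_add, map_smul, smul_add]
      abel
    · have hqj := hq j
      have e1 := mul_lt_mul_of_pos_left (h12 j) hs
      have e2 := mul_lt_mul_of_pos_left (h22 j) ht
      simp only [Pi.add_apply, Pi.smul_apply, smul_eq_mul, map_add, map_smul, Prod.snd_add,
        Prod.fst_add, Prod.smul_snd, Prod.smul_fst] at hqj ⊢
      linarith
    · have e1 := mul_lt_mul_of_pos_left h13 hs
      have e2 := mul_lt_mul_of_pos_left h23 ht
      simp only [smul_eq_mul, map_add, map_smul, Prod.snd_add, Prod.smul_snd]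
      linarith
  have h0 : (0 : (ι → ℝ) × (κ → ℝ) × ℝ) ∉ K := by
    rintro ⟨x, z, h1, h2, h3⟩
    exact absurd (hinf x z h1.symm h2) (not_le.2 h3)
  obtain ⟨φ, hφ⟩ := geometric_hahn_banach_point_open hconvex hopen h0
  set lam : ι → ℝ := fun i => φ (Pi.single i 1, 0, 0) with hlam
  set mu : κ → ℝ := fun j => φ (0, Pi.single j 1, 0) with hmu
  set mu₀ : ℝ := φ (0, 0, 1) with hmu₀
  have hrep : ∀ u v w, φ (u, v, w) = ∑ i, lam i * u i + ∑ j, mu j * v j + mu₀ * w := by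
    intro u v w
    have e1 : φ (u, 0, 0) = ∑ i, lam i * u i :=
      ((φ : ((ι → ℝ) × (κ → ℝ) × ℝ) →ₗ[ℝ] ℝ).comp (LinearMap.inl ℝ _ _)).pi_eq_sum u
    have e2 : φ (0, v, 0) = ∑ j, mu j * v j :=
      ((φ : ((ι → ℝ) × (κ → ℝ) × ℝ) →ₗ[ℝ] ℝ).comp
        ((LinearMap.inr ℝ _ _).comp (LinearMap.inl ℝ _ _))).pi_eq_sum v
    have e3 : φ (0, 0, w) = mu₀ * w := by
      have : ((0 : ι → ℝ), (0 : κ → ℝ), w) = w • (0, 0, 1) := by simp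
      rw [this, map_smul, smul_eq_mul, mul_comm]
    rw [← e1, ← e2, ← e3, ← map_add, ← map_add]
    simp
  have hpos : ∀ x z (s : κ → ℝ) (s₀ : ℝ), (∀ j, 0 < s j) → 0 < s₀ →
      0 < ∑ i, lam i * (a z i + p x i) + ∑ j, mu j * (b z j + q x j + s j)
        + mu₀ * (c z + r x + s₀) := by
    intro x z s s₀ hs hs₀
    have := hφ (a z + p x, fun j => b z j + q x j + s j, c z + r x + s₀)
      ⟨x, z, rfl, fun j => by simpa using hs j, by simpa using hs₀⟩
    rw [map_zero, hrep] at this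
    exact this
  obtain ⟨x₀⟩ := ‹Nonempty X›
  refine ⟨lam, mu, mu₀, fun k => ?_, ?_, ?_, fun z => ?_, fun x => ?_⟩
  · refine (nonneg_and_nonneg_of_forall_pos (A := ∑ i, lam i * (a 0 i + p x₀ i)
      + ∑ j, mu j * (b 0 j + q x₀ j + 1) + mu₀ * (c 0 + r x₀ + 1)) fun t ht => ?_).2
    have := hpos x₀ 0 (fun j => 1 + t * (Pi.single k 1 : κ → ℝ) j) 1 (fun j => by
      have : (0 : ℝ) ≤ (Pi.single k 1 : κ → ℝ) j := by
        rw [Pi.single_apply]; split_ifs <;> norm_num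
      positivity) one_pos
    refine this.trans_eq ?_
    have hsum : ∑ j, mu j * (b 0 j + q x₀ j + (1 + t * (Pi.single k 1 : κ → ℝ) j))
        = ∑ j, mu j * (b 0 j + q x₀ j + 1) + t * mu k := by
      have : t * mu k = ∑ j, t * (mu j * (Pi.single k 1 : κ → ℝ) j) := by
        simp [Pi.single_apply]
      rw [this, ← Finset.sum_add_distrib]
      exact Finset.sum_congr rfl fun j _ => by ring
    rw [hsum]
    ring
  · refine (nonneg_and_nonneg_of_forall_pos (A := ∑ i, lam i * (a 0 i + p x₀ i)
      + ∑ j, mu j * (b 0 j + q x₀ j + 1) + mu₀ * (c 0 + r x₀ + 1)) fun t ht => ?_).2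
    have := hpos x₀ 0 (fun j => 1) (1 + t) (fun j => one_pos) (by positivity)
    refine this.trans_eq ?_
    ring
  · rintro ⟨h1, h2, h3⟩
    have := hpos x₀ 0 1 1 (fun j => one_pos) one_pos
    rw [h1, h2, h3] at this
    simp at this
  · have key : ∀ z, 0 ≤ ∑ i, lam i * a z i + ∑ j, mu j * b z j + mu₀ * c z := by
      intro z
      refine (nonneg_and_nonneg_of_forall_pos (A := ∑ i, lam i * p x₀ i
        + ∑ j, mu j * (q x₀ j + 1) + mu₀ * (r x₀ + 1)) fun t ht => ?_).2
      have := hpos x₀ (t • z) 1 1 (fun j => one_pos) one_pos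
      refine this.trans_eq ?_
      simp only [map_smul, Pi.smul_apply, smul_eq_mul, Pi.one_apply, mul_add, Finset.mul_sum,
        Finset.sum_add_distrib, mul_left_comm t]
      ring
    have h1 := key z
    have h2 := key (-z)
    simp only [map_neg, Pi.neg_apply, mul_neg, Finset.sum_neg_distrib] at h2
    linarith
  · refine (nonneg_and_nonneg_of_forall_pos (B := ∑ j, mu j + mu₀) fun t ht => ?_).1
    have := hpos x 0 (fun _ => t) t (fun j => ht) ht
    refine this.trans_eq ?_
    simp only [map_zero, Pi.zero_apply, zero_add, mul_add, Finset.sum_add_distrib,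
      ← Finset.sum_mul]
    ring

/-! ### One multiplier for a convex family of directions -/

theorem Fintype.sum_eq_sum_set_coe {α : Type*} [Fintype α] (s : Set α) [Fintype s] (F : α → ℝ)
    (h : ∀ j, j ∉ s → F j = 0) : ∑ j, F j = ∑ j : s, F j := by
  rw [← Finset.sum_subset (Finset.subset_univ s.toFinset) fun j _ hj => h j (by simpa using hj)]
  exact Finset.sum_subtype _ (fun x => by simp) F

namespace NLP

variable {n m p : ℕ} {P : NLP n m p} {xs : EuclideanSpace ℝ (Fin n)}

/-- The active inequalities whose gradients are orthogonal to the whole critical cone. -/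
def rigid (P : NLP n m p) (xs : EuclideanSpace ℝ (Fin n)) : Set (Fin p) :=
  {j | j ∈ P.active xs ∧ ∀ d ∈ P.criticalCone xs, fderiv ℝ (P.g j) xs d = 0}

theorem mem_criticalCone_iff {d : EuclideanSpace ℝ (Fin n)} :
    d ∈ P.criticalCone xs ↔ fderiv ℝ P.f xs d = 0 ∧ (∀ i, fderiv ℝ (P.h i) xs d = 0) ∧
      ∀ j ∈ P.active xs, fderiv ℝ (P.g j) xs d ≤ 0 := by
  simp only [criticalCone, Set.mem_ofPred_eq, inner_gradient_left]

/-- Some critical direction is strictly decreasing for all active inequalities that are not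
rigid. -/
theorem exists_criticalCone_neg (P : NLP n m p) (xs : EuclideanSpace ℝ (Fin n)) :
    ∃ d ∈ P.criticalCone xs, ∀ j ∈ P.active xs, j ∉ P.rigid xs → fderiv ℝ (P.g j) xs d < 0 := by
  have h : ∀ j, ∃ d ∈ P.criticalCone xs,
      j ∈ P.active xs → j ∉ P.rigid xs → fderiv ℝ (P.g j) xs d < 0 := by
    intro j
    by_cases hj : j ∈ P.active xs ∧ j ∉ P.rigid xs
    · obtain ⟨d, hd, hne⟩ : ∃ d ∈ P.criticalCone xs, fderiv ℝ (P.g j) xs d ≠ 0 := by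
        by_contra! hall
        exact hj.2 ⟨hj.1, hall⟩
      exact ⟨d, hd, fun _ _ => lt_of_le_of_ne ((mem_criticalCone_iff.1 hd).2.2 j hj.1) hne⟩
    · exact ⟨0, mem_criticalCone_iff.2 (by simp), fun h1 h2 => absurd ⟨h1, h2⟩ hj⟩
  choose d hd hneg using h
  simp only [mem_criticalCone_iff] at hd
  refine ⟨∑ k, d k, mem_criticalCone_iff.2 ⟨?_, fun i => ?_, fun j hj => ?_⟩, fun j hj hr => ?_⟩
  · rw [map_sum]; exact Finset.sum_eq_zero fun k _ => (hd k).1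
  · rw [map_sum]; exact Finset.sum_eq_zero fun k _ => (hd k).2.1 i
  · rw [map_sum]; exact Finset.sum_nonpos fun k _ => (hd k).2.2 j hj
  · rw [map_sum]
    exact Finset.sum_neg' (fun k _ => (hd k).2.2 j hj) ⟨j, Finset.mem_univ j, hneg j hj hr⟩

/-- If a family of critical directions (up to sign) is convex, in the sense that the second-order
data of the constraints and the objective can be averaged within the family up to a first-order
correction `z`, then one multiplier makes the Hessian of the Lagrangian nonnegative along the whole
family. -/
theorem IsLocalMinimizer.exists_multiplier (hmin : P.IsLocalMinimizer xs) (hP : P.IsC2)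
    (hM : P.MFCQ xs) {X : Type*} [Nonempty X] (dir : X → EuclideanSpace ℝ (Fin n))
    (hdir : ∀ x, dir x ∈ P.criticalCone xs ∨ -dir x ∈ P.criticalCone xs)
    (hconv : ∀ x₁ x₂ (s t : ℝ), 0 < s → 0 < t → s + t = 1 → ∃ x z,
      (∀ i, fderiv ℝ (P.h i) xs z + fderiv ℝ (fderiv ℝ (P.h i)) xs (dir x) (dir x)
        = s * fderiv ℝ (fderiv ℝ (P.h i)) xs (dir x₁) (dir x₁)
          + t * fderiv ℝ (fderiv ℝ (P.h i)) xs (dir x₂) (dir x₂)) ∧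
      (∀ j ∈ P.rigid xs,
        fderiv ℝ (P.g j) xs z + fderiv ℝ (fderiv ℝ (P.g j)) xs (dir x) (dir x)
        ≤ s * fderiv ℝ (fderiv ℝ (P.g j)) xs (dir x₁) (dir x₁)
          + t * fderiv ℝ (fderiv ℝ (P.g j)) xs (dir x₂) (dir x₂)) ∧
      fderiv ℝ P.f xs z + fderiv ℝ (fderiv ℝ P.f) xs (dir x) (dir x)
        ≤ s * fderiv ℝ (fderiv ℝ P.f) xs (dir x₁) (dir x₁)
          + t * fderiv ℝ (fderiv ℝ P.f) xs (dir x₂) (dir x₂)) :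
    ∃ (lam : Fin m → ℝ) (mu : Fin p → ℝ), (∀ j, 0 ≤ mu j) ∧ (∀ j, j ∉ P.rigid xs → mu j = 0) ∧
      (∀ z, fderiv ℝ P.f xs z + ∑ i, lam i * fderiv ℝ (P.h i) xs z
        + ∑ j, mu j * fderiv ℝ (P.g j) xs z = 0) ∧
      ∀ x, 0 ≤ fderiv ℝ (fderiv ℝ P.f) xs (dir x) (dir x)
        + ∑ i, lam i * fderiv ℝ (fderiv ℝ (P.h i)) xs (dir x) (dir x)
        + ∑ j, mu j * fderiv ℝ (fderiv ℝ (P.g j)) xs (dir x) (dir x) := by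
  classical
  obtain ⟨δ, hδ, hδneg⟩ := P.exists_criticalCone_neg xs
  have hδ' := mem_criticalCone_iff.1 hδ
  have hsq : ∀ (B : EuclideanSpace ℝ (Fin n) →L[ℝ] EuclideanSpace ℝ (Fin n) →L[ℝ] ℝ) d,
      B (-d) (-d) = B d d := fun B d => by simp
  obtain ⟨lam, mu, mu₀, hmu, hmu₀, hne, hst, hval⟩ :=
    exists_multiplier_of_infeasible
      (ContinuousLinearMap.pi fun i => fderiv ℝ (P.h i) xs)
      (ContinuousLinearMap.pi fun j : P.rigid xs => fderiv ℝ (P.g j) xs)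
      (fderiv ℝ P.f xs) hM.surjective_fderiv
      (fun x i => fderiv ℝ (fderiv ℝ (P.h i)) xs (dir x) (dir x))
      (fun x (j : P.rigid xs) => fderiv ℝ (fderiv ℝ (P.g j)) xs (dir x) (dir x))
      (fun x => fderiv ℝ (fderiv ℝ P.f) xs (dir x) (dir x))
      (by
        intro x₁ x₂ s t hs ht hst
        obtain ⟨x, z, h1, h2, h3⟩ := hconv x₁ x₂ s t hs ht hst
        exact ⟨x, z, funext h1, fun j => h2 j j.2, h3⟩)
      (by
        intro x z h1 h2
        -- Far along `δ` the rows that are not rigid hold strictly; the others do not change.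
        have hT : ∀ j, ∀ᶠ t : ℝ in Filter.atTop, j ∈ P.active xs → j ∉ P.rigid xs →
            fderiv ℝ (P.g j) xs (z + t • δ)
              + fderiv ℝ (fderiv ℝ (P.g j)) xs (dir x) (dir x) < 0 := by
          intro j
          by_cases hj : j ∈ P.active xs ∧ j ∉ P.rigid xs
          · have hn := hδneg j hj.1 hj.2
            filter_upwards [Filter.eventually_gt_atTop ((fderiv ℝ (P.g j) xs z
              + fderiv ℝ (fderiv ℝ (P.g j)) xs (dir x) (dir x)) / (-fderiv ℝ (P.g j) xs δ))]
              with t ht _ _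
            rw [div_lt_iff₀ (neg_pos.2 hn)] at ht
            simp only [map_add, map_smul, smul_eq_mul]
            linarith
          · exact Filter.Eventually.of_forall fun t h1 h2 => absurd ⟨h1, h2⟩ hj
        obtain ⟨t, ht⟩ := (Filter.eventually_all.2 hT).exists
        have hrig : ∀ j ∈ P.active xs, fderiv ℝ (P.g j) xs (z + t • δ)
            + fderiv ℝ (fderiv ℝ (P.g j)) xs (dir x) (dir x) < 0 := by
          intro j hj
          by_cases hr : j ∈ P.rigid xs
          · have := h2 ⟨j, hr⟩
            simpa [hr.2 δ hδ] using this
          · exact ht j hj hr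
        have heq : ∀ i, fderiv ℝ (P.h i) xs (z + t • δ)
            + fderiv ℝ (fderiv ℝ (P.h i)) xs (dir x) (dir x) = 0 := by
          intro i
          simpa [hδ'.2.1 i] using congrFun h1 i
        have hfin : fderiv ℝ P.f xs (z + t • δ) = fderiv ℝ P.f xs z := by simp [hδ'.1]
        rw [← hfin]
        rcases hdir x with hd | hd
        · exact hmin.second_order_primal hP hM hd heq fun j hj _ => hrig j hj
        · rw [← hsq]
          refine hmin.second_order_primal hP hM hd ?_ ?_
          · intro i; rw [hsq]; exact heq i
          · intro j hj _; rw [hsq]; exact hrig j hj)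
  simp only [ContinuousLinearMap.coe_pi'] at hst
  -- The constraint qualification makes the multiplier of the objective positive.
  have hpos : 0 < mu₀ := by
    refine lt_of_le_of_ne hmu₀ fun h0 => hne ?_
    rw [← h0] at hst
    obtain ⟨d, hdh, hdg⟩ := hM.2
    simp only [inner_gradient_left] at hdh hdg
    have h1 := hst d
    simp only [hdh, mul_zero, Finset.sum_const_zero, zero_add, zero_mul, add_zero] at h1
    have hmu0 : mu = 0 := by
      have h2 := (Finset.sum_eq_zero_iff_of_nonpos fun j _ =>
        mul_nonpos_of_nonneg_of_nonpos (hmu j) (hdg j j.2.1).le).1 h1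
      funext j
      exact (mul_eq_zero.1 (h2 j (Finset.mem_univ j))).resolve_right (hdg j j.2.1).ne
    obtain ⟨z, hz⟩ := hM.surjective_fderiv lam
    have h3 := hst z
    have hz' : ∀ i, fderiv ℝ (P.h i) xs z = lam i := fun i => congrFun hz i
    simp only [hmu0, hz', Pi.zero_apply, zero_mul, Finset.sum_const_zero, add_zero] at h3
    refine ⟨funext fun i => ?_, hmu0, h0.symm⟩
    exact mul_self_eq_zero.1 ((Finset.sum_eq_zero_iff_of_nonneg fun i _ =>
      mul_self_nonneg (lam i)).1 h3 i (Finset.mem_univ i))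
  have hsum : ∀ F : Fin p → ℝ,
      ∑ j, (if hj : j ∈ P.rigid xs then mu ⟨j, hj⟩ / mu₀ else 0) * F j
        = (∑ j : P.rigid xs, mu j * F j) / mu₀ := by
    intro F
    rw [Fintype.sum_eq_sum_set_coe (P.rigid xs) _ fun j hj => by simp [hj], Finset.sum_div]
    exact Finset.sum_congr rfl fun j _ => by rw [dif_pos j.2]; ring
  refine ⟨fun i => lam i / mu₀,
    fun j => if hj : j ∈ P.rigid xs then mu ⟨j, hj⟩ / mu₀ else 0, fun j => ?_, fun j hj => ?_,
    fun z => ?_, fun x => ?_⟩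
  · dsimp only
    split_ifs with hj
    · exact div_nonneg (hmu _) hmu₀
    · exact le_rfl
  · simp [hj]
  · rw [hsum]
    simp only [div_mul_eq_mul_div, ← Finset.sum_div]
    field_simp
    linarith [hst z]
  · rw [hsum]
    simp only [div_mul_eq_mul_div, ← Finset.sum_div]
    have := div_nonneg (hval x) hmu₀
    refine this.trans_eq ?_
    field_simp
    ring

end NLP

/-! ### Second derivatives and the smooth singular value decomposition -/

theorem Matrix.eq_zero_of_mulVec_eq_zero_of_orthogonal_cols {ι κ : Type*} [Fintype ι] [Fintype κ]
    {M : Matrix ι κ ℝ} (h0 : ∀ k, M.col k ≠ 0) (horth : ∀ k l, k ≠ l → M.col k ⬝ᵥ M.col l = 0)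
    {y : κ → ℝ} (hy : M.mulVec y = 0) : y = 0 := by
  classical
  funext k
  have h1 : (M.transpose.mulVec (M.mulVec y)) k = y k * (M.col k ⬝ᵥ M.col k) := by
    rw [Matrix.mulVec_mulVec, Matrix.mulVec, dotProduct, Finset.sum_eq_single k]
    · rw [mul_comm]; rfl
    · intro l _ hl
      have : (M.transpose * M) k l = M.col k ⬝ᵥ M.col l := rfl
      rw [this, horth k l hl.symm, zero_mul]
    · simp
  rw [hy, Matrix.mulVec_zero] at h1
  exact (mul_eq_zero.1 h1.symm).resolve_right fun h => h0 k (dotProduct_self_eq_zero.1 h)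

/-- If `Σ` is diagonal and its diagonal vanishes past the rank `r` of `U Σ Vᵀ`, then the first `r`
diagonal entries are nonzero. -/
theorem Matrix.diag_ne_zero_of_lt_rank {ι : Type*} [Fintype ι] {N n : ℕ}
    {U : Matrix ι (Fin N) ℝ} {S : Matrix (Fin N) (Fin n) ℝ} {W : Matrix (Fin n) (Fin n) ℝ}
    (hoff : ∀ i k, i.val ≠ k.val → S i k = 0)
    (hbig : ∀ i k, i.val = k.val → (U * S * W).rank < i.val + 1 → S i k = 0)
    {i : Fin N} {k : Fin n} (hik : i.val = k.val) (hi : i.val < (U * S * W).rank) : S i k ≠ 0 := by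
  intro h0
  set r := (U * S * W).rank with hr
  set e : Fin N → ℝ := fun l => if l.val < r ∧ l ≠ i then 1 else 0 with he
  have hS : S = Matrix.diagonal e * S := by
    ext l b
    rw [Matrix.diagonal_mul]
    by_cases hl : l.val < r ∧ l ≠ i
    · simp [he, hl]
    · suffices S l b = 0 by simp [this]
      by_cases hlb : l.val = b.val
      · rw [not_and_or, not_not] at hl
        rcases hl with hl | rfl
        · exact hbig l b hlb (by omega)
        · rwa [show b = k from Fin.ext (hlb.symm.trans hik)]
      · exact hoff l b hlb
  have h1 : r ≤ S.rank := (Matrix.rank_mul_le_left _ _).trans (Matrix.rank_mul_le_right _ _)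
  have h2 : S.rank ≤ Fintype.card {l // e l ≠ 0} := by
    conv_lhs => rw [hS]
    exact (Matrix.rank_mul_le_left _ _).trans (Matrix.rank_diagonal e).le
  have h3 : Fintype.card {l // e l ≠ 0} ≤ ((Finset.range r).erase i.val).card := by
    rw [Fintype.card_subtype]
    refine Finset.card_le_card_of_injOn Fin.val (fun l hl => ?_) Fin.val_injective.injOn
    simp only [he, ne_eq, ite_eq_right_iff, one_ne_zero, imp_false, not_not,
      Finset.coe_filter, Finset.mem_univ, true_and] at hl
    have hl' : l.val < r ∧ l ≠ i := hl
    simp only [Finset.coe_erase, Finset.coe_range, Set.mem_sdiff, Set.mem_Iio,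
      Set.mem_singleton_iff]
    exact ⟨hl'.1, fun h => hl'.2 (Fin.ext h)⟩
  rw [Finset.card_erase_of_mem (Finset.mem_range.2 hi), Finset.card_range] at h3
  omega

/-- A product of three functions whose outer factors vanish wherever the middle one does not has
the derivative obtained by differentiating the middle factor only. -/
theorem HasFDerivAt.mul_mul_of_eq_zero {E : Type*} [NormedAddCommGroup E] [NormedSpace ℝ E]
    {f g h : E → ℝ} {f' g' h' : E →L[ℝ] ℝ} {a : E} (hf : HasFDerivAt f f' a)
    (hg : HasFDerivAt g g' a) (hh : HasFDerivAt h h' a) (hfg : g a * f a = 0)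
    (hgh : g a * h a = 0) :
    HasFDerivAt (fun x => f x * g x * h x) ((f a * h a) • g') a := by
  refine ((hf.mul hg).mul hh).congr_fderiv ?_
  ext d
  simp only [add_apply, smul_apply, smul_eq_mul, Pi.mul_apply]
  linear_combination (f' d) * hgh + (h' d) * hfg

/-- Near a point `a`, let the rank of the Jacobian of `c` exceed its value at `a` by at most one,
and let the Jacobian have a smooth singular value decomposition. Then the second derivatives at `a`,
combined with coefficients `w` in the left kernel of the Jacobian and evaluated at a kernel vector
in one argument, are all multiples of a single bilinear form of rank one: differentiating
`∑ σᵢ uᵢ vᵢᵀ`, the terms with `σᵢ(a) ≠ 0` do not contribute since `w` is orthogonal to `uᵢ(a)` and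
the kernel vector to `vᵢ(a)`, and only one `σᵢ` vanishes at `a` but not identically nearby. -/
theorem exists_rank_one_of_smooth_svd {ι : Type*} [Fintype ι] {N n : ℕ}
    {c : ι → EuclideanSpace ℝ (Fin n) → ℝ} (hc : ∀ i, ContDiff ℝ 2 (c i))
    {J : EuclideanSpace ℝ (Fin n) → Matrix ι (Fin n) ℝ}
    (hJ : ∀ x i k, J x i k = gradient (c i) x k) {a : EuclideanSpace ℝ (Fin n)}
    (hrank : ∀ᶠ x in 𝓝 a, (J x).rank ≤ (J a).rank + 1)
    {U : EuclideanSpace ℝ (Fin n) → Matrix ι (Fin N) ℝ}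
    {S : EuclideanSpace ℝ (Fin n) → Matrix (Fin N) (Fin n) ℝ}
    {V : EuclideanSpace ℝ (Fin n) → Matrix (Fin n) (Fin n) ℝ}
    (hUd : ∀ i k, DifferentiableAt ℝ (fun y => U y i k) a)
    (hSd : ∀ i k, DifferentiableAt ℝ (fun y => S y i k) a)
    (hVd : ∀ i k, DifferentiableAt ℝ (fun y => V y i k) a)
    (hsvd : ∀ᶠ x in 𝓝 a, J x = U x * S x * (V x).transpose)
    (hoff : ∀ᶠ x in 𝓝 a, ∀ i k, i.val ≠ k.val → S x i k = 0)
    (hbig : ∀ᶠ x in 𝓝 a, ∀ i k, i.val = k.val → (J x).rank < i.val + 1 → S x i k = 0)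
    (hU0 : ∀ k, (U a).col k ≠ 0) (hUo : ∀ k l, k ≠ l → (U a).col k ⬝ᵥ (U a).col l = 0)
    (hV0 : ∀ k, (V a).col k ≠ 0) (hVo : ∀ k l, k ≠ l → (V a).col k ⬝ᵥ (V a).col l = 0) :
    ∃ (ℓ : EuclideanSpace ℝ (Fin n) →L[ℝ] ℝ) (v : EuclideanSpace ℝ (Fin n)),
      (∀ i, fderiv ℝ (c i) a v = 0) ∧
      ∀ w : ι → ℝ, (∀ z, ∑ i, w i * fderiv ℝ (c i) a z = 0) →
        ∃ α : ℝ, ∀ d y, (∀ i, fderiv ℝ (c i) a y = 0) →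
          ∑ i, w i * fderiv ℝ (fderiv ℝ (c i)) a d y = α * ℓ d * inner ℝ v y := by
  classical
  set r := (J a).rank with hr
  have hJd : ∀ x y i, fderiv ℝ (c i) x y = (J x).mulVec y i := by
    intro x y i
    rw [← inner_gradient_left, PiLp.inner_apply, Matrix.mulVec, dotProduct]
    refine Finset.sum_congr rfl fun k _ => ?_
    rw [hJ]
    simp [mul_comm]
  have hsvda := hsvd.self_of_nhds
  have hoffa := hoff.self_of_nhds
  have hbiga := hbig.self_of_nhds
  have hSne : ∀ i k, i.val = k.val → i.val < r → S a i k ≠ 0 := by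
    intro i k hik hi
    rw [hr, hsvda] at hi
    rw [hsvda] at hbiga
    exact Matrix.diag_ne_zero_of_lt_rank hoffa hbiga hik hi
  have hS' : ∀ i k, ¬(i.val = r ∧ k.val = r) → S a i k = 0 →
      fderiv ℝ (fun x => S x i k) a = 0 := by
    intro i k hik h0
    have hev : (fun x => S x i k) =ᶠ[𝓝 a] fun _ => 0 := by
      by_cases hne : i.val = k.val
      · have hi : ¬ i.val < r := fun h => hSne i k hne h h0
        filter_upwards [hrank, hbig] with x h1 h2
        exact h2 i k hne (by omega)
      · filter_upwards [hoff] with x h1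
        exact h1 i k hne
    rw [hev.fderiv_eq, fderiv_fun_const]
    rfl
  have hleft : ∀ w : ι → ℝ, (∀ z, ∑ i, w i * fderiv ℝ (c i) a z = 0) →
      ∀ i k, S a i k * ((U a).transpose.mulVec w) i = 0 := by
    intro w hw i k
    by_cases hik : i.val = k.val
    · have h1 : Matrix.vecMul w (J a) = 0 := by
        funext b
        have := hw (EuclideanSpace.single b 1)
        simp only [hJd] at this
        rw [Pi.zero_apply, ← this, Matrix.vecMul, dotProduct]
        refine Finset.sum_congr rfl fun l _ => ?_
        congr 1
        simp [Matrix.mulVec, dotProduct]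
      rw [hsvda, ← Matrix.vecMul_vecMul, Matrix.vecMul_transpose, ← Matrix.vecMul_vecMul] at h1
      have h2 := congrFun (Matrix.eq_zero_of_mulVec_eq_zero_of_orthogonal_cols hV0 hVo h1) k
      rw [Matrix.vecMul, dotProduct, Finset.sum_eq_single i] at h2
      · rw [Matrix.mulVec_transpose, mul_comm]; exact h2
      · intro l _ hl
        rw [hoffa l k (fun h => hl (Fin.ext (h.trans hik.symm))), mul_zero]
      · simp
    · rw [hoffa i k hik, zero_mul]
  have hright : ∀ y : EuclideanSpace ℝ (Fin n), (∀ i, fderiv ℝ (c i) a y = 0) →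
      ∀ i k, S a i k * ((V a).transpose.mulVec y) k = 0 := by
    intro y hy i k
    by_cases hik : i.val = k.val
    · have h1 : (J a).mulVec y = 0 := funext fun l => by rw [← hJd, hy]; rfl
      rw [hsvda, ← Matrix.mulVec_mulVec, ← Matrix.mulVec_mulVec] at h1
      have h2 := congrFun (Matrix.eq_zero_of_mulVec_eq_zero_of_orthogonal_cols hU0 hUo h1) i
      rw [Matrix.mulVec, dotProduct, Finset.sum_eq_single k] at h2
      · exact h2
      · intro l _ hl
        rw [hoffa i l (fun h => hl (Fin.ext (h.symm.trans hik))), zero_mul]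
      · simp
    · rw [hoffa i k hik, zero_mul]
  have hmain : ∀ w : ι → ℝ, (∀ z, ∑ i, w i * fderiv ℝ (c i) a z = 0) →
      ∀ d y : EuclideanSpace ℝ (Fin n), (∀ i, fderiv ℝ (c i) a y = 0) →
      ∑ i, w i * fderiv ℝ (fderiv ℝ (c i)) a d y = ∑ i, ∑ k,
        ((U a).transpose.mulVec w) i * ((V a).transpose.mulVec y) k
          * fderiv ℝ (fun x => S x i k) a d := by
    intro w hw d y hy
    have hL : HasFDerivAt (fun x => ∑ i, w i * fderiv ℝ (c i) x y)
        (∑ i, w i • (fderiv ℝ (fderiv ℝ (c i)) a).flip y) a := by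
      refine HasFDerivAt.fun_sum fun i _ => HasFDerivAt.const_mul ?_ (w i)
      have hdd : HasFDerivAt (fderiv ℝ (c i)) (fderiv ℝ (fderiv ℝ (c i)) a) a :=
        (((hc i).fderiv_right (m := 1) (by norm_num)).differentiable (by simp) a).hasFDerivAt
      refine (hdd.clm_apply (hasFDerivAt_const y a)).congr_fderiv ?_
      ext z
      simp
    have hR : HasFDerivAt (fun x => ∑ i, ∑ k, ((U x).transpose.mulVec w) i * S x i k
          * ((V x).transpose.mulVec y) k)
        (∑ i, ∑ k, (((U a).transpose.mulVec w) i * ((V a).transpose.mulVec y) k)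
          • fderiv ℝ (fun x => S x i k) a) a := by
      refine HasFDerivAt.fun_sum fun i _ => HasFDerivAt.fun_sum fun k _ => ?_
      have hu : DifferentiableAt ℝ (fun x => ((U x).transpose.mulVec w) i) a := by
        simp only [Matrix.mulVec, dotProduct, Matrix.transpose_apply]
        exact DifferentiableAt.fun_sum fun l _ => (hUd l i).mul_const _
      have hv : DifferentiableAt ℝ (fun x => ((V x).transpose.mulVec y) k) a := by
        simp only [Matrix.mulVec, dotProduct, Matrix.transpose_apply]
        exact DifferentiableAt.fun_sum fun l _ => (hVd l k).mul_const _
      exact HasFDerivAt.mul_mul_of_eq_zero hu.hasFDerivAt (hSd i k).hasFDerivAt hv.hasFDerivAt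
        (hleft w hw i k) (hright y hy i k)
    have heq : (fun x => ∑ i, w i * fderiv ℝ (c i) x y) =ᶠ[𝓝 a] fun x => ∑ i, ∑ k,
        ((U x).transpose.mulVec w) i * S x i k * ((V x).transpose.mulVec y) k := by
      filter_upwards [hsvd] with x hx
      have h1 : ∑ i, w i * fderiv ℝ (c i) x y = w ⬝ᵥ (J x).mulVec y :=
        Finset.sum_congr rfl fun i _ => by rw [hJd]
      rw [h1, hx, ← Matrix.mulVec_mulVec, ← Matrix.mulVec_mulVec, Matrix.dotProduct_mulVec,
        ← Matrix.mulVec_transpose, dotProduct]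
      refine Finset.sum_congr rfl fun i _ => ?_
      have h2 : (S x).mulVec ((V x).transpose.mulVec y) i
        = ∑ k, S x i k * ((V x).transpose.mulVec y) k := rfl
      rw [h2, Finset.mul_sum]
      exact Finset.sum_congr rfl fun k _ => by ring
    have := DFunLike.congr_fun (hL.unique (hR.congr_of_eventuallyEq heq)) d
    simpa [sum_apply] using this
  have hzero : ∀ w : ι → ℝ, (∀ z, ∑ i, w i * fderiv ℝ (c i) a z = 0) →
      ∀ d y : EuclideanSpace ℝ (Fin n), (∀ i, fderiv ℝ (c i) a y = 0) →
      ∀ (i : Fin N) (k : Fin n), ¬(i.val = r ∧ k.val = r) →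
        ((U a).transpose.mulVec w) i * ((V a).transpose.mulVec y) k
          * fderiv ℝ (fun x => S x i k) a d = 0 := by
    intro w hw d y hy i k hik
    by_cases h0 : S a i k = 0
    · rw [hS' i k hik h0]; simp
    · rw [(mul_eq_zero.1 (hleft w hw i k)).resolve_left h0]; simp
  by_cases hex : ∃ (i : Fin N) (k : Fin n), i.val = r ∧ k.val = r
  · obtain ⟨i₀, k₀, hi₀, hk₀⟩ := hex
    refine ⟨fderiv ℝ (fun x => S x i₀ k₀) a, WithLp.toLp 2 ((V a).col k₀), fun i => ?_,
      fun w hw => ⟨((U a).transpose.mulVec w) i₀, fun d y hy => ?_⟩⟩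
    · have hSv : (S a).mulVec ((V a).transpose.mulVec ((V a).col k₀)) = 0 := by
        funext l
        rw [Matrix.mulVec, dotProduct]
        refine Finset.sum_eq_zero fun k _ => ?_
        by_cases hk : k = k₀
        · rw [hk]
          by_cases hl : l.val = k₀.val
          · rw [hbiga l k₀ hl (by omega), zero_mul]
          · rw [hoffa l k₀ hl, zero_mul]
        · have : ((V a).transpose.mulVec ((V a).col k₀)) k = (V a).col k ⬝ᵥ (V a).col k₀ := rfl
          rw [this, hVo k k₀ hk, mul_zero]
      rw [hJd, hsvda, ← Matrix.mulVec_mulVec, ← Matrix.mulVec_mulVec]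
      simp [hSv]
    · rw [hmain w hw d y hy, Finset.sum_eq_single i₀, Finset.sum_eq_single k₀]
      · have : inner ℝ (WithLp.toLp 2 ((V a).col k₀)) y = ((V a).transpose.mulVec y) k₀ := by
          rw [PiLp.inner_apply, Matrix.mulVec, dotProduct]
          exact Finset.sum_congr rfl fun k _ => by simp [mul_comm]
        rw [this]
        ring
      · exact fun k _ hk => hzero w hw d y hy i₀ k fun h => hk (Fin.ext (h.2.trans hk₀.symm))
      · simp
      · exact fun i _ hi => Finset.sum_eq_zero fun k _ =>
          hzero w hw d y hy i k fun h => hi (Fin.ext (h.1.trans hi₀.symm))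
      · simp
  · refine ⟨0, 0, by simp, fun w hw => ⟨0, fun d y hy => ?_⟩⟩
    rw [hmain w hw d y hy, zero_mul, zero_mul]
    exact Finset.sum_eq_zero fun i _ => Finset.sum_eq_zero fun k _ =>
      hzero w hw d y hy i k fun h => hex ⟨i, k, h⟩

/-! ### Hidden convexity of pairs of squares -/

/-- Replacing `(d₁, d₂)` by a rotated pair does not change `d₁ ⊗ d₁ + d₂ ⊗ d₂`, and the rotation may
be chosen so that a given functional vanishes at the second vector. -/
theorem exists_rotation_annihilating {E : Type*} [NormedAddCommGroup E] [NormedSpace ℝ E]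
    (φ : E →L[ℝ] ℝ) (d₁ d₂ : E) :
    ∃ e₁ e₂ : E, φ e₂ = 0 ∧
      (∀ W : Submodule ℝ E, d₁ ∈ W → d₂ ∈ W → e₁ ∈ W ∧ e₂ ∈ W) ∧
      (∀ ψ : E →L[ℝ] ℝ, ψ e₁ ^ 2 + ψ e₂ ^ 2 = ψ d₁ ^ 2 + ψ d₂ ^ 2) ∧
      ∀ B : E →L[ℝ] E →L[ℝ] ℝ, B e₁ e₁ + B e₂ e₂ = B d₁ d₁ + B d₂ d₂ := by
  obtain ⟨c, s, hcs, h0⟩ : ∃ c s : ℝ, c ^ 2 + s ^ 2 = 1 ∧ -s * φ d₁ + c * φ d₂ = 0 := by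
    by_cases h : φ d₁ ^ 2 + φ d₂ ^ 2 = 0
    · have h1 : φ d₁ = 0 := by nlinarith [sq_nonneg (φ d₁), sq_nonneg (φ d₂)]
      have h2 : φ d₂ = 0 := by nlinarith [sq_nonneg (φ d₁), sq_nonneg (φ d₂)]
      exact ⟨1, 0, by norm_num, by simp [h1, h2]⟩
    · have hpos : 0 < φ d₁ ^ 2 + φ d₂ ^ 2 := lt_of_le_of_ne (by positivity) (Ne.symm h)
      have hsq := Real.sq_sqrt hpos.le
      have hs := Real.sqrt_pos.2 hpos
      refine ⟨φ d₁ / √(φ d₁ ^ 2 + φ d₂ ^ 2), φ d₂ / √(φ d₁ ^ 2 + φ d₂ ^ 2), ?_, by ring⟩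
      rw [div_pow, div_pow, hsq, ← add_div, div_self h]
  refine ⟨c • d₁ + s • d₂, -s • d₁ + c • d₂, by simpa using h0, fun W h1 h2 =>
    ⟨W.add_mem (W.smul_mem _ h1) (W.smul_mem _ h2), W.add_mem (W.smul_mem _ h1) (W.smul_mem _ h2)⟩,
    fun ψ => ?_, fun B => ?_⟩
  · simp only [map_add, map_smul, smul_eq_mul]
    linear_combination (ψ d₁ ^ 2 + ψ d₂ ^ 2) * hcs
  · simp only [map_add, map_smul, smul_eq_mul, add_apply, smul_apply]
    linear_combination (B d₁ d₁ + B d₂ d₂) * hcs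

/-- The joint range of two squares of linear functionals and an arbitrary quadratic form is convex
up to increasing the value of the form. -/
theorem exists_add_sq_add_sq_and_le {E : Type*} [NormedAddCommGroup E] [NormedSpace ℝ E]
    (a s : E →L[ℝ] ℝ) (Q : E →L[ℝ] E →L[ℝ] ℝ) (d₁ d₂ : E) :
    ∃ d : E, (∀ W : Submodule ℝ E, d₁ ∈ W → d₂ ∈ W → d ∈ W) ∧
      a d ^ 2 = a d₁ ^ 2 + a d₂ ^ 2 ∧ s d ^ 2 = s d₁ ^ 2 + s d₂ ^ 2 ∧
      Q d d ≤ Q d₁ d₁ + Q d₂ d₂ := by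
  obtain ⟨e₁, e₂, ha, hW, hψ, hB⟩ := exists_rotation_annihilating a d₁ d₂
  -- It is enough to find a suitable `y` and to take `e₁ + y • e₂`.
  suffices h : ∃ y : ℝ, (s e₁ + y * s e₂) ^ 2 = s e₁ ^ 2 + s e₂ ^ 2 ∧
      y * (Q e₁ e₂ + Q e₂ e₁) + (y ^ 2 - 1) * Q e₂ e₂ ≤ 0 by
    obtain ⟨y, h1, h2⟩ := h
    refine ⟨e₁ + y • e₂, fun W w1 w2 => W.add_mem (hW W w1 w2).1 (W.smul_mem _ (hW W w1 w2).2),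
      ?_, ?_, ?_⟩
    · rw [← hψ a]
      simp [ha]
    · rw [← hψ s, ← h1]
      simp
    · rw [← hB Q]
      simp only [map_add, map_smul, smul_eq_mul, add_apply, smul_apply]
      linarith
  by_cases hs : s e₂ = 0
  · rcases le_total (Q e₁ e₂ + Q e₂ e₁) 0 with h | h
    · exact ⟨1, by rw [hs]; ring, by linarith⟩
    · exact ⟨-1, by rw [hs]; ring, by linarith⟩
  · -- The two solutions of the equation for `y` have product `-1`, and the expressions to be
    -- made nonpositive have opposite signs at them.
    set R := √(s e₁ ^ 2 + s e₂ ^ 2) with hR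
    have hRsq : R ^ 2 = s e₁ ^ 2 + s e₂ ^ 2 := Real.sq_sqrt (by positivity)
    set y := (R - s e₁) / s e₂ with hy
    set y' := (-R - s e₁) / s e₂ with hy'
    have h1 : y * s e₂ = R - s e₁ := div_mul_cancel₀ _ hs
    have h2 : y' * s e₂ = -R - s e₁ := div_mul_cancel₀ _ hs
    have hyy : y * y' = -1 := by
      have : (y * y' + 1) * s e₂ ^ 2 = 0 := by
        linear_combination (y' * s e₂) * h1 + (R - s e₁) * h2 - hRsq
      rcases mul_eq_zero.1 this with h | h
      · linarith
      · exact absurd (pow_eq_zero_iff two_ne_zero |>.1 h) hs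
    rcases le_or_gt (y * (Q e₁ e₂ + Q e₂ e₁) + (y ^ 2 - 1) * Q e₂ e₂) 0 with h | h
    · exact ⟨y, by rw [h1, ← hRsq]; ring, h⟩
    · refine ⟨y', by rw [h2, ← hRsq]; ring, ?_⟩
      have e : y' * (Q e₁ e₂ + Q e₂ e₁) + (y' ^ 2 - 1) * Q e₂ e₂
          = -(y' ^ 2 * (y * (Q e₁ e₂ + Q e₂ e₁) + (y ^ 2 - 1) * Q e₂ e₂)) := by
        linear_combination (y' * (Q e₁ e₂ + Q e₂ e₁) + (y * y' - 1) * Q e₂ e₂) * hyy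
      rw [e]
      exact neg_nonpos.2 (mul_nonneg (sq_nonneg _) h.le)

namespace NLP

variable {n m p : ℕ} {P : NLP n m p} {xs : EuclideanSpace ℝ (Fin n)}

/-- The combination of the Hessians of the constraints with coefficients `lam`, `mu`, as a bilinear
form. -/
def constraintHessian (P : NLP n m p) (xs : EuclideanSpace ℝ (Fin n)) (lam : Fin m → ℝ)
    (mu : Fin p → ℝ) : EuclideanSpace ℝ (Fin n) →L[ℝ] EuclideanSpace ℝ (Fin n) →L[ℝ] ℝ :=
  ∑ i, lam i • fderiv ℝ (fderiv ℝ (P.h i)) xs + ∑ j, mu j • fderiv ℝ (fderiv ℝ (P.g j)) xs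

theorem constraintHessian_apply (lam : Fin m → ℝ) (mu : Fin p → ℝ)
    (d y : EuclideanSpace ℝ (Fin n)) :
    P.constraintHessian xs lam mu d y = ∑ i, lam i * fderiv ℝ (fderiv ℝ (P.h i)) xs d y
      + ∑ j, mu j * fderiv ℝ (fderiv ℝ (P.g j)) xs d y := by
  simp [constraintHessian, sum_apply]

theorem IsC2.constraintHessian_symm (hP : P.IsC2) (lam : Fin m → ℝ) (mu : Fin p → ℝ)
    (d y : EuclideanSpace ℝ (Fin n)) :
    P.constraintHessian xs lam mu d y = P.constraintHessian xs lam mu y d := by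
  have h1 : ∀ i, fderiv ℝ (fderiv ℝ (P.h i)) xs d y = fderiv ℝ (fderiv ℝ (P.h i)) xs y d :=
    fun i => ((hP.2.1 i).contDiffAt.isSymmSndFDerivAt (by simp)).eq d y
  have h2 : ∀ j, fderiv ℝ (fderiv ℝ (P.g j)) xs d y = fderiv ℝ (fderiv ℝ (P.g j)) xs y d :=
    fun j => ((hP.2.2 j).contDiffAt.isSymmSndFDerivAt (by simp)).eq d y
  simp only [constraintHessian_apply, h1, h2]

/-- The pair `(lam, mu)` is a linear relation between the constraint gradients, with `mu` supported
on `s`: an element of the left kernel of the Jacobian of the equalities and the inequalities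
in `s`. -/
def IsRelation (P : NLP n m p) (xs : EuclideanSpace ℝ (Fin n)) (s : Set (Fin p))
    (lam : Fin m → ℝ) (mu : Fin p → ℝ) : Prop :=
  (∀ j, j ∉ s → mu j = 0) ∧
    ∀ z, ∑ i, lam i * fderiv ℝ (P.h i) xs z + ∑ j, mu j * fderiv ℝ (P.g j) xs z = 0

/-- The kernel of the Jacobian of the equalities and the inequalities in `s`. -/
def tangentSpace (P : NLP n m p) (xs : EuclideanSpace ℝ (Fin n)) (s : Set (Fin p)) :
    Submodule ℝ (EuclideanSpace ℝ (Fin n)) where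
  carrier := {d | (∀ i, fderiv ℝ (P.h i) xs d = 0) ∧ ∀ j ∈ s, fderiv ℝ (P.g j) xs d = 0}
  add_mem' := fun h1 h2 => ⟨fun i => by simp [h1.1 i, h2.1 i],
    fun j hj => by simp [h1.2 j hj, h2.2 j hj]⟩
  zero_mem' := by simp
  smul_mem' := fun c _ h => ⟨fun i => by simp [h.1 i], fun j hj => by simp [h.2 j hj]⟩

theorem mem_tangentSpace {s : Set (Fin p)} {d : EuclideanSpace ℝ (Fin n)} :
    d ∈ P.tangentSpace xs s ↔
      (∀ i, fderiv ℝ (P.h i) xs d = 0) ∧ ∀ j ∈ s, fderiv ℝ (P.g j) xs d = 0 :=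
  Iff.rfl

theorem exists_of_forall_isRelation (s : Set (Fin p)) (b : Fin m → ℝ) (b' : Fin p → ℝ)
    (h : ∀ lam mu, P.IsRelation xs s lam mu → ∑ i, lam i * b i + ∑ j, mu j * b' j = 0) :
    ∃ z, (∀ i, fderiv ℝ (P.h i) xs z = b i) ∧ ∀ j ∈ s, fderiv ℝ (P.g j) xs z = b' j := by
  classical
  obtain ⟨z, hz⟩ := exists_eq_of_forall_left_ker
    (Sum.elim (fun i => fderiv ℝ (P.h i) xs) (fun j : s => fderiv ℝ (P.g j) xs))
    (Sum.elim b fun j : s => b' j) (by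
      intro w hw
      have hsum : ∀ F : Fin p → ℝ, ∑ j, (if hj : j ∈ s then w (Sum.inr ⟨j, hj⟩) else 0) * F j
          = ∑ j : s, w (Sum.inr j) * F j := fun F => by
        rw [Fintype.sum_eq_sum_set_coe s _ fun j hj => by simp [hj]]
        exact Finset.sum_congr rfl fun j _ => by rw [dif_pos j.2]
      have := h (fun i => w (Sum.inl i)) (fun j => if hj : j ∈ s then w (Sum.inr ⟨j, hj⟩) else 0)
        ⟨fun j hj => by simp [hj], fun z => by
          rw [hsum]
          simpa using hw z⟩
      rw [hsum] at this
      simpa using this)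
  exact ⟨z, fun i => hz (Sum.inl i), fun j hj => hz (Sum.inr ⟨j, hj⟩)⟩

/-- The smooth singular value decomposition of the Jacobian makes the Hessians of all relations
between the active constraints proportional to one rank-one form, as soon as one argument is in the
kernel of the Jacobian. -/
theorem HasSmoothSVD.exists_rank_one (hSVD : P.HasSmoothSVD xs) (hP : P.IsC2)
    (hrank : P.RankIncreasesAtMostOne xs) :
    ∃ (ℓ : EuclideanSpace ℝ (Fin n) →L[ℝ] ℝ), ∃ v ∈ P.tangentSpace xs (P.active xs),
      ∀ lam mu, P.IsRelation xs (P.active xs) lam mu →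
        ∃ α : ℝ, ∀ d, ∀ y ∈ P.tangentSpace xs (P.active xs),
          P.constraintHessian xs lam mu d y = α * ℓ d * inner ℝ v y := by
  obtain ⟨U, S, V, hev, hU0, hUo, hV0, hVo⟩ := hSVD
  have ha := hev.self_of_nhds
  obtain ⟨ℓ, v, hv, hw⟩ := exists_rank_one_of_smooth_svd (ι := Fin m ⊕ P.active xs)
    (c := Sum.elim P.h fun j : P.active xs => P.g j)
    (by rintro (i | j); exacts [hP.2.1 i, hP.2.2 j]) (J := P.jacobian xs)
    (by rintro x (i | j) k <;> rfl) hrank ha.1 ha.2.1 ha.2.2.1 (hev.mono fun x h => h.2.2.2.1)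
    (hev.mono fun x h => h.2.2.2.2.1) (hev.mono fun x h => h.2.2.2.2.2) hU0 hUo hV0 hVo
  refine ⟨ℓ, v, ⟨fun i => hv (Sum.inl i), fun j hj => hv (Sum.inr ⟨j, hj⟩)⟩,
    fun lam mu hrel => ?_⟩
  have hsum : ∀ F : Fin p → ℝ, ∑ j, mu j * F j = ∑ j : P.active xs, mu j * F j := fun F =>
    Fintype.sum_eq_sum_set_coe (P.active xs) _ fun j hj => by rw [hrel.1 j hj, zero_mul]
  obtain ⟨α, hα⟩ := hw (Sum.elim lam fun j => mu j) fun z => by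
    have := hrel.2 z
    rw [hsum] at this
    simpa using this
  refine ⟨α, fun d y hy => ?_⟩
  rw [← hα d y (by rintro (i | j); exacts [hy.1 i, hy.2 j j.2]), constraintHessian_apply, hsum]
  simp

/-! ### The family of constraint Hessians on the tangent space -/

/-- If all active inequalities but at most one are rigid, a vector tangent to the rigid constraints
becomes tangent to all active ones after subtracting a multiple of a fixed vector, the coefficient
being a linear functional. -/
theorem exists_sub_smul_mem_tangentSpace
    (hsub : (P.active xs \ P.rigid xs).Subsingleton) :
    ∃ (s : EuclideanSpace ℝ (Fin n) →L[ℝ] ℝ) (d₀ : EuclideanSpace ℝ (Fin n)),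
      ∀ d ∈ P.tangentSpace xs (P.rigid xs), d - s d • d₀ ∈ P.tangentSpace xs (P.active xs) := by
  obtain ⟨δ, hδ, hneg⟩ := P.exists_criticalCone_neg xs
  have hδ' := mem_criticalCone_iff.1 hδ
  rcases (P.active xs \ P.rigid xs).eq_empty_or_nonempty with hemp | ⟨j₀, hj₀⟩
  · refine ⟨0, 0, fun d hd => ?_⟩
    have : P.active xs ⊆ P.rigid xs := Set.sdiff_eq_empty.1 hemp
    simpa using mem_tangentSpace.2 ⟨hd.1, fun j hj => hd.2 j (this hj)⟩
  · have hc := (hneg j₀ hj₀.1 hj₀.2).ne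
    refine ⟨(fderiv ℝ (P.g j₀) xs δ)⁻¹ • fderiv ℝ (P.g j₀) xs, δ, fun d hd =>
      ⟨fun i => by simp [hd.1 i, hδ'.2.1 i], fun j hj => ?_⟩⟩
    by_cases hr : j ∈ P.rigid xs
    · simp [hd.2 j hr, hr.2 δ hδ]
    · rw [hsub ⟨hj, hr⟩ hj₀]
      simp only [map_sub, map_smul, smul_apply, smul_eq_mul]
      field_simp
      ring

/-- The quadratic forms of all relations between the rigid constraints, together with one further
form `Q`, have a convex joint range on the tangent space, up to increasing the value of `Q`. -/
theorem exists_constraintHessian_add (hP : P.IsC2) (hrank : P.RankIncreasesAtMostOne xs)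
    (hSVD : P.HasSmoothSVD xs) (hsub : (P.active xs \ P.rigid xs).Subsingleton)
    (Q : EuclideanSpace ℝ (Fin n) →L[ℝ] EuclideanSpace ℝ (Fin n) →L[ℝ] ℝ)
    (hQ : ∀ y ∈ P.tangentSpace xs (P.rigid xs),
      (∀ lam mu, P.IsRelation xs (P.rigid xs) lam mu → P.constraintHessian xs lam mu y y = 0) →
      0 ≤ Q y y)
    {d₁ d₂ : EuclideanSpace ℝ (Fin n)} (hd₁ : d₁ ∈ P.tangentSpace xs (P.rigid xs))
    (hd₂ : d₂ ∈ P.tangentSpace xs (P.rigid xs)) :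
    ∃ d ∈ P.tangentSpace xs (P.rigid xs),
      (∀ lam mu, P.IsRelation xs (P.rigid xs) lam mu →
        P.constraintHessian xs lam mu d d = P.constraintHessian xs lam mu d₁ d₁
          + P.constraintHessian xs lam mu d₂ d₂) ∧
      Q d d ≤ Q d₁ d₁ + Q d₂ d₂ := by
  obtain ⟨s, d₀, hs⟩ := exists_sub_smul_mem_tangentSpace hsub
  obtain ⟨ℓ, v, hv, hℓ⟩ := hSVD.exists_rank_one hP hrank
  set τ : EuclideanSpace ℝ (Fin n) →L[ℝ] ℝ :=
    (innerSL ℝ v).comp (ContinuousLinearMap.id ℝ _ - s.smulRight d₀) with hτ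
  have hτd : ∀ d, τ d = inner ℝ v (d - s d • d₀) := fun d => by
    simp [hτ, inner_sub_right, real_inner_smul_right]
  -- For `v = 0` this is `0`, which is harmless since the forms do not depend on `ℓ` then.
  set κ : ℝ := ℓ v / inner ℝ v v with hκ
  set ρ : ℝ := ℓ d₀ with hρ
  -- Symmetry of second derivatives makes `ℓ` proportional to `⟪v, ·⟫` on the kernel.
  have hform : ∀ lam mu, P.IsRelation xs (P.rigid xs) lam mu → ∃ α β : ℝ,
      ∀ d ∈ P.tangentSpace xs (P.rigid xs), P.constraintHessian xs lam mu d d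
        = α * (κ * τ d ^ 2 + 2 * ρ * s d * τ d) + β * s d ^ 2 := by
    intro lam mu hrel
    obtain ⟨α, hα⟩ := hℓ lam mu ⟨fun j hj => hrel.1 j fun h => hj h.1, hrel.2⟩
    have hsymm := hP.constraintHessian_symm (xs := xs) lam mu
    refine ⟨α, P.constraintHessian xs lam mu d₀ d₀, fun d hd => ?_⟩
    set y := d - s d • d₀ with hy
    have hyT : y ∈ P.tangentSpace xs (P.active xs) := hs d hd
    have hdy : d = y + s d • d₀ := by rw [hy]; abel
    have hprop : α * ℓ y * inner ℝ v y = α * κ * inner ℝ v y ^ 2 := by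
      by_cases hv0 : v = 0
      · simp [hv0]
      · have h1 := hα y v hv
        rw [hsymm, hα v y hyT] at h1
        have h2 : (inner ℝ v v : ℝ) ≠ 0 := by simpa using hv0
        rw [hκ]
        field_simp
        linear_combination -(inner ℝ v y : ℝ) * h1
    have e1 := hα d y hyT
    have e2 := hα d₀ y hyT
    rw [hsymm] at e2
    have e3 : P.constraintHessian xs lam mu d d = P.constraintHessian xs lam mu d y
        + s d * P.constraintHessian xs lam mu d d₀ := by
      conv_lhs => rw [show P.constraintHessian xs lam mu d d
        = P.constraintHessian xs lam mu d (y + s d • d₀) by rw [← hdy]]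
      simp
    have e4 : P.constraintHessian xs lam mu d d₀ = P.constraintHessian xs lam mu y d₀
        + s d * P.constraintHessian xs lam mu d₀ d₀ := by
      conv_lhs => rw [hdy]
      simp
    have e5 : ℓ d = ℓ y + s d * ρ := by
      conv_lhs => rw [hdy]
      simp [hρ]
    rw [hτd, e3, e1, e4, e2, e5]
    linear_combination hprop
  by_cases hκ0 : κ = 0
  · -- Now every form vanishes where `s` does, so the rotated vector `e₂` can be dropped.
    obtain ⟨e₁, e₂, hse, hW, -, hB⟩ := exists_rotation_annihilating s d₁ d₂
    obtain ⟨he₁, he₂⟩ := hW _ hd₁ hd₂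
    have hz : ∀ lam mu, P.IsRelation xs (P.rigid xs) lam mu →
        P.constraintHessian xs lam mu e₂ e₂ = 0 := by
      intro lam mu hrel
      obtain ⟨α, β, h⟩ := hform lam mu hrel
      rw [h e₂ he₂, hκ0, hse]
      ring
    refine ⟨e₁, he₁, fun lam mu hrel => ?_, ?_⟩
    · rw [← hB, hz lam mu hrel, add_zero]
    · rw [← hB]
      linarith [hQ e₂ he₂ hz]
  · -- Completing the square turns the forms into combinations of two squares.
    obtain ⟨d, hW, ha, hsd, hQd⟩ := exists_add_sq_add_sq_and_le (τ + (ρ / κ) • s) s Q d₁ d₂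
    have hd := hW _ hd₁ hd₂
    refine ⟨d, hd, fun lam mu hrel => ?_, hQd⟩
    obtain ⟨α, β, h⟩ := hform lam mu hrel
    have hsq : ∀ x, κ * τ x ^ 2 + 2 * ρ * s x * τ x
        = κ * (τ + (ρ / κ) • s) x ^ 2 - ρ ^ 2 / κ * s x ^ 2 := by
      intro x
      simp only [add_apply, smul_apply, smul_eq_mul]
      field_simp
      ring
    rw [h d hd, h d₁ hd₁, h d₂ hd₂, hsq, hsq, hsq, ha, hsd]
    ring

/-! ### Multipliers and the Lagrangian -/

theorem IsC2.hasFDerivAt_lagrangian (hP : P.IsC2) (lam : Fin m → ℝ) (mu : Fin p → ℝ)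
    (x : EuclideanSpace ℝ (Fin n)) :
    HasFDerivAt (P.lagrangian lam mu) (fderiv ℝ P.f x + ∑ i, lam i • fderiv ℝ (P.h i) x
      + ∑ j, mu j • fderiv ℝ (P.g j) x) x :=
  (((hP.1.differentiable (by simp) x).hasFDerivAt.add
    (HasFDerivAt.fun_sum fun i _ =>
      ((hP.2.1 i).differentiable (by simp) x).hasFDerivAt.const_mul (lam i))).add
    (HasFDerivAt.fun_sum fun j _ =>
      ((hP.2.2 j).differentiable (by simp) x).hasFDerivAt.const_mul (mu j)))

theorem IsC2.fderiv_fderiv_lagrangian (hP : P.IsC2) (lam : Fin m → ℝ) (mu : Fin p → ℝ) :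
    fderiv ℝ (fderiv ℝ (P.lagrangian lam mu)) xs
      = fderiv ℝ (fderiv ℝ P.f) xs + P.constraintHessian xs lam mu := by
  have h1 : fderiv ℝ (P.lagrangian lam mu) = fun x => fderiv ℝ P.f x
      + ∑ i, lam i • fderiv ℝ (P.h i) x + ∑ j, mu j • fderiv ℝ (P.g j) x :=
    funext fun x => (hP.hasFDerivAt_lagrangian lam mu x).fderiv
  have h2 : ∀ {φ : EuclideanSpace ℝ (Fin n) → ℝ}, ContDiff ℝ 2 φ →
      HasFDerivAt (fderiv ℝ φ) (fderiv ℝ (fderiv ℝ φ) xs) xs := fun hφ =>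
    ((hφ.fderiv_right (m := 1) (by norm_num)).differentiable (by simp) xs).hasFDerivAt
  rw [h1, constraintHessian, ← add_assoc]
  exact (((h2 hP.1).add (HasFDerivAt.fun_sum fun i _ => (h2 (hP.2.1 i)).const_smul (lam i))).add
    (HasFDerivAt.fun_sum fun j _ => (h2 (hP.2.2 j)).const_smul (mu j))).fderiv

theorem IsC2.gradient_lagrangian_eq_zero_iff (hP : P.IsC2) (lam : Fin m → ℝ) (mu : Fin p → ℝ) :
    gradient (P.lagrangian lam mu) xs = 0 ↔ ∀ z, fderiv ℝ P.f xs z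
      + ∑ i, lam i * fderiv ℝ (P.h i) xs z + ∑ j, mu j * fderiv ℝ (P.g j) xs z = 0 := by
  have h1 : ∀ z, inner ℝ (gradient (P.lagrangian lam mu) xs) z = fderiv ℝ P.f xs z
      + ∑ i, lam i * fderiv ℝ (P.h i) xs z + ∑ j, mu j * fderiv ℝ (P.g j) xs z := fun z => by
    rw [inner_gradient_left, (hP.hasFDerivAt_lagrangian lam mu xs).fderiv]
    simp [sum_apply]
  simp only [← h1]
  exact ⟨fun h z => by rw [h, inner_zero_left], fun h => inner_self_eq_zero.1 (h _)⟩

/-- Multipliers vanish off the rigid constraints: if `μⱼ > 0`, then stationarity tested on a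
critical direction `d` forces `∇gⱼᵀ d = 0`. -/
theorem eq_zero_of_mem_multipliers (hP : P.IsC2) (hfeas : xs ∈ P.feasible)
    {q : (Fin m → ℝ) × (Fin p → ℝ)} (hq : q ∈ P.multipliers xs) {j : Fin p}
    (hj : j ∉ P.rigid xs) : q.2 j = 0 := by
  obtain ⟨hgrad, hnn, hcs⟩ := hq
  rw [hP.gradient_lagrangian_eq_zero_iff] at hgrad
  have hact : ∀ k, q.2 k ≠ 0 → k ∈ P.active xs := fun k hk => by
    have := (Finset.sum_eq_zero_iff_of_nonpos fun k _ =>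
      mul_nonpos_of_nonneg_of_nonpos (hnn k) (hfeas.2 k)).1 hcs k (Finset.mem_univ k)
    exact (mul_eq_zero.1 this).resolve_left hk
  by_contra hne
  refine hj ⟨hact j hne, fun d hd => ?_⟩
  rw [mem_criticalCone_iff] at hd
  have h1 := hgrad d
  simp only [hd.1, hd.2.1, mul_zero, Finset.sum_const_zero, zero_add] at h1
  have h2 := (Finset.sum_eq_zero_iff_of_nonpos fun k _ => by
    by_cases hk : q.2 k = 0
    · rw [hk, zero_mul]
    · exact mul_nonpos_of_nonneg_of_nonpos (hnn k) (hd.2.2 k (hact k hk))).1 h1 j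
        (Finset.mem_univ j)
  exact (mul_eq_zero.1 h2).resolve_left hne

theorem mem_multipliers_of_support (hP : P.IsC2) {lam : Fin m → ℝ} {mu : Fin p → ℝ}
    (hmu : ∀ j, 0 ≤ mu j) (hsupp : ∀ j, j ∉ P.rigid xs → mu j = 0)
    (hst : ∀ z, fderiv ℝ P.f xs z + ∑ i, lam i * fderiv ℝ (P.h i) xs z
      + ∑ j, mu j * fderiv ℝ (P.g j) xs z = 0) : (lam, mu) ∈ P.multipliers xs := by
  refine ⟨(hP.gradient_lagrangian_eq_zero_iff lam mu).2 hst, hmu,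
    Finset.sum_eq_zero fun j _ => ?_⟩
  by_cases hj : j ∈ P.rigid xs
  · have : P.g j xs = 0 := hj.1
    rw [this, mul_zero]
  · exact mul_eq_zero_of_left (hsupp j hj) _

theorem criticalCone_subset_tangentSpace :
    P.criticalCone xs ⊆ P.tangentSpace xs (P.rigid xs) := fun d hd =>
  ⟨(mem_criticalCone_iff.1 hd).2.1, fun _ hj => hj.2 d hd⟩

/-- If all active inequalities but at most one are rigid, the tangent space of the rigid constraints
is the union of the critical cone and its negative. -/
theorem mem_criticalCone_or_neg_mem (hsub : (P.active xs \ P.rigid xs).Subsingleton)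
    {d : EuclideanSpace ℝ (Fin n)} (hd : d ∈ P.tangentSpace xs (P.rigid xs))
    (hf : fderiv ℝ P.f xs d = 0) : d ∈ P.criticalCone xs ∨ -d ∈ P.criticalCone xs := by
  simp only [mem_criticalCone_iff, map_neg, hf, hd.1, neg_zero, implies_true, true_and]
  by_contra! h
  obtain ⟨⟨j, hj, hj'⟩, k, hk, hk'⟩ := h
  have hjr : j ∉ P.rigid xs := fun hr => by have := hd.2 j hr; linarith
  have hkr : k ∉ P.rigid xs := fun hr => by have := hd.2 k hr; linarith
  rw [hsub ⟨hk, hkr⟩ ⟨hj, hjr⟩] at hk'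
  linarith

end NLP

end

theorem theorem3p5 {n m p : ℕ} (P : NLP n m p) (hP : P.IsC2)
    (xs : EuclideanSpace ℝ (Fin n)) (hmin : P.IsLocalMinimizer xs) (hMFCQ : P.MFCQ xs)
    (hrank : P.RankIncreasesAtMostOne xs) (hSVD : P.HasSmoothSVD xs) (hGSCS : P.GSCS xs) :
    P.SSOC xs := by
  obtain ⟨lam₀, mu₀, hmu₀, hsupp₀, hst₀, -⟩ := hmin.exists_multiplier hP hMFCQ
    (fun _ : Unit => 0) (fun _ => Or.inl (NLP.mem_criticalCone_iff.2 (by simp)))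
    (fun _ _ s t _ _ _ => ⟨(), 0, by simp⟩)
  -- The zero direction has produced a multiplier; it serves as a reference from here on.
  have hsub : (P.active xs \ P.rigid xs).Subsingleton := hGSCS.anti fun j hj =>
    ⟨hj.1, fun q hq => NLP.eq_zero_of_mem_multipliers hP hmin.1 hq hj.2⟩
  have hcone : ∀ d ∈ P.tangentSpace xs (P.rigid xs),
      d ∈ P.criticalCone xs ∨ -d ∈ P.criticalCone xs := fun d hd => by
    refine NLP.mem_criticalCone_or_neg_mem hsub hd ?_
    have h1 := hst₀ d
    rwa [Finset.sum_eq_zero fun i _ => by rw [hd.1 i, mul_zero], Finset.sum_eq_zero fun j _ => by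
      by_cases hj : j ∈ P.rigid xs
      · rw [hd.2 j hj, mul_zero]
      · rw [hsupp₀ j hj, zero_mul], add_zero, add_zero] at h1
  set Q := fderiv ℝ (fderiv ℝ P.f) xs + P.constraintHessian xs lam₀ mu₀ with hQdef
  have hQ : ∀ y ∈ P.tangentSpace xs (P.rigid xs),
      (∀ lam mu, P.IsRelation xs (P.rigid xs) lam mu → P.constraintHessian xs lam mu y y = 0) →
      0 ≤ Q y y := by
    intro y hy hz
    -- The second-order condition holds along `y` for some multiplier, hence for the reference one:
    -- their difference is a relation, whose form vanishes at `y`.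
    obtain ⟨lam, mu, -, hsupp, hst, hval⟩ := hmin.exists_multiplier hP hMFCQ
      (fun _ : Unit => y) (fun _ => hcone y hy)
      (fun _ _ s t _ _ hst => ⟨(), 0, by simp [← add_mul, hst]⟩)
    have h0 := hz (lam - lam₀) (mu - mu₀) ⟨fun j hj => by simp [hsupp j hj, hsupp₀ j hj],
      fun z => by
        simp only [Pi.sub_apply, sub_mul, Finset.sum_sub_distrib]
        linarith [hst z, hst₀ z]⟩
    have h1 := hval ()
    simp only [NLP.constraintHessian_apply, Pi.sub_apply, sub_mul, Finset.sum_sub_distrib] at h0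
    simp only [hQdef, add_apply, NLP.constraintHessian_apply]
    linarith
  obtain ⟨lam, mu, hmu, hsupp, hst, hval⟩ := hmin.exists_multiplier hP hMFCQ
    (fun d : P.tangentSpace xs (P.rigid xs) => (d : EuclideanSpace ℝ (Fin n)))
    (fun d => hcone d d.2) (by
      rintro ⟨d₁, hd₁⟩ ⟨d₂, hd₂⟩ s t hs ht -
      obtain ⟨d, hd, hadd, hle⟩ := NLP.exists_constraintHessian_add hP hrank hSVD hsub Q hQ
        (Submodule.smul_mem _ (√s) hd₁) (Submodule.smul_mem _ (√t) hd₂)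
      have hsmul : ∀ {c : ℝ}, 0 < c → ∀ (B : EuclideanSpace ℝ (Fin n) →L[ℝ]
          EuclideanSpace ℝ (Fin n) →L[ℝ] ℝ) (x : EuclideanSpace ℝ (Fin n)),
          B (√c • x) (√c • x) = c * B x x := fun hc B x => by
        simp only [map_smul, smul_apply, smul_eq_mul, ← mul_assoc, Real.mul_self_sqrt hc.le]
      simp only [hsmul hs, hsmul ht] at hadd hle
      obtain ⟨z, hzh, hzg⟩ := NLP.exists_of_forall_isRelation (P := P) (xs := xs) (P.rigid xs)
        (fun i => s * fderiv ℝ (fderiv ℝ (P.h i)) xs d₁ d₁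
          + t * fderiv ℝ (fderiv ℝ (P.h i)) xs d₂ d₂ - fderiv ℝ (fderiv ℝ (P.h i)) xs d d)
        (fun j => s * fderiv ℝ (fderiv ℝ (P.g j)) xs d₁ d₁
          + t * fderiv ℝ (fderiv ℝ (P.g j)) xs d₂ d₂ - fderiv ℝ (fderiv ℝ (P.g j)) xs d d)
        (fun lam mu hrel => by
          have h1 := hadd lam mu hrel
          simp only [NLP.constraintHessian_apply] at h1
          simp only [mul_sub, mul_add, Finset.sum_sub_distrib, Finset.sum_add_distrib,
            mul_left_comm _ s, mul_left_comm _ t, ← Finset.mul_sum]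
          linarith)
      refine ⟨⟨d, hd⟩, z, fun i => by rw [hzh]; ring, fun j hj => by rw [hzg j hj]; linarith, ?_⟩
      -- Stationarity of the reference multiplier expresses `∇f z` through the constraint rows.
      have h1 := hst₀ z
      have h2 : ∑ j, mu₀ j * fderiv ℝ (P.g j) xs z
          = ∑ j, mu₀ j * (s * fderiv ℝ (fderiv ℝ (P.g j)) xs d₁ d₁
          + t * fderiv ℝ (fderiv ℝ (P.g j)) xs d₂ d₂ - fderiv ℝ (fderiv ℝ (P.g j)) xs d d) := by
        refine Finset.sum_congr rfl fun j _ => ?_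
        by_cases hj : j ∈ P.rigid xs
        · rw [hzg j hj]
        · rw [hsupp₀ j hj, zero_mul, zero_mul]
      simp only [h2, hzh, mul_sub, mul_add, Finset.sum_sub_distrib, Finset.sum_add_distrib,
        mul_left_comm _ s, mul_left_comm _ t, ← Finset.mul_sum] at h1
      simp only [hQdef, add_apply, NLP.constraintHessian_apply] at hle
      linarith)
  refine ⟨(lam, mu), NLP.mem_multipliers_of_support hP hmu hsupp hst, fun d hd => ?_⟩
  rw [hP.fderiv_fderiv_lagrangian]
  have := hval ⟨d, NLP.criticalCone_subset_tangentSpace hd⟩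
  rw [add_apply, add_apply, NLP.constraintHessian_apply, ← add_assoc]
  exact this
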